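/- **Setting.** Let $U=\{x_1,\dots,x_N\}$ be a universe of records with measurable per-sample losses $\ell_i:\mathbb R^d\to\mathbb R$, and let $S_1,\dots,S_M\subseteq U$ ($M\ge 1$) be subsets such that every record lies in exactly $M/2$ of them. The secret dataset is $S^*=S_{j^*}$ with $j^*$ uniform on $\{1,\dots,M\}$. **PACZero-MI** with total budget $\mathrm{MI}_{\mathrm{tot}}>0$, $T$ steps, perturbation scale $\mu>0$, clipping level $c\in[0,\infty]$, learning rates $\eta_t$, weight decay $\lambda$ and initial parameters $\theta_1$ starts from $p_1[m]=1/M$ and $\mathrm{MI}_{\mathrm{used}}^{(0)}=0$. With the convention $\mathrm{sign}(0)=+1$, step $t=1,\dots,T$ does the following. 1. Draw a public direction $z_t\sim\mathcal N(0,I_d)$. Put $\hat g_i=\frac{\ell_i(\theta_t+\mu z_t)-\ell_i(\theta_t-\mu z_t)}{2\mu}$, clip it to $\mathrm{sign}(\hat g_i)\min(|\hat g_i|,c)$, and let $s_m\in\{-1,+1\}$ be the sign of the mean of the clipped values over $S_m$ (the mean over an empty set is $0$). Let $q_t^+=\sum_m p_t[m]\,\mathbf 1[s_m=+1]$. 2.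 If $q_t^+\in\{0,1\}$ (unanimity): $\tilde Y_t=s_{j^*}$, $\beta_t^{\mathrm{used}}=0$, $p_{t+1}=p_t$. 3. Otherwise (disagreement): let $$\beta_t=\min\Big(\tfrac{\max(0,\,\mathrm{MI}_{\mathrm{tot}}-\mathrm{MI}_{\mathrm{used}}^{(t-1)})}{T-t+1},\;0.999\,h(q_t^+)\Big),$$ where $h(q)=-q\ln q-(1-q)\ln(1-q)$, and let $\sigma_t>0$ be the solution of $I(\xi;\xi+\mathcal N(0,\sigma_t^2))=\beta_t$ (in nats) for $\xi\in\{-1,+1\}$ with $P(\xi=+1)=q_t^+$. Put $\tilde Y_t=s_{j^*}+\mathcal N(0,\sigma_t^2)$ with fresh noise, $\beta_t^{\mathrm{used}}=\beta_t$, and $p_{t+1}[m]\propto p_t[m]\,\phi_{\sigma_t}(\tilde Y_t-s_m)$, where $\phi_\sigma$ is the density of $\mathcal N(0,\sigma^2)$. 4. Release $Y_t=\mathrm{sign}(\tilde Y_t)$. Set $\theta_{t+1}=(1-\eta_t\lambda)\theta_t-\eta_tY_tz_t$ and $\mathrm{MI}_{\mathrm{used}}^{(t)}=\mathrm{MI}_{\mathrm{used}}^{(t-1)}+\beta_t^{\mathrm{used}}$.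 The index $j^*$, the directions and the noises are independent. **Claim.** Fix a record $x_i\in U$ and let $\rho_i(X,\hat X)=1$ if and only if $X$ and $\hat X$ agree on whether they contain $x_i$. Then: (a) The prior membership-inference success rate $$1-\delta_0=\max_Q\Pr_{\hat X\sim Q}[\rho_i(S^*,\hat X)=1],$$ where the maximum is over all distributions $Q$ on subsets of $U$ and $\hat X$ is independent of $S^*$, equals $1/2$. (b) For every (possibly randomized, measurable) adversary $\mathcal A$ who observes the released bits $Y_{1:T}$ and the public directions $z_{1:T}$ and outputs a subset of $U$, the success rate $1-\delta_{\mathcal A}=\Pr[\rho_i(S^*,\mathcal A(z_{1:T},Y_{1:T}))=1]$ satisfies $$\mathrm{KL}\big(1-\delta_{\mathcal A}\,\big\|\,1/2\big)\le \mathrm{MI}_{\mathrm{tot}},$$ where $\mathrm{KL}(p\|q)=p\ln\frac pq+(1-p)\ln\frac{1-p}{1-q}$ with $0\ln0=0$. -/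

import Mathlib

open MeasureTheory ProbabilityTheory
open scoped ENNReal

noncomputable section

namespace PACZero

/-! ### Success rates of attacks, and the binary divergence -/

/-- `Pr_{X, X̂ ∼ Q}[ρ(X, X̂) = 1]`: success rate of guessing the secret dataset `X` (a random
variable on `(Ω, P)`) by an independent draw from `Q`, without observing anything. -/
def blindSuccess {Ω 𝒳 : Type*} [MeasurableSpace Ω] (P : Measure Ω) (X : Ω → 𝒳)
    (ρ : 𝒳 → 𝒳 → Bool) (Q : PMF 𝒳) : ℝ :=
  ∫ ω, (Q.toOuterMeasure {x' | ρ (X ω) x' = true}).toReal ∂P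

/-- `r` is the prior success rate `1 - δ₀ = max_Q Pr_{X, X̂ ∼ Q}[ρ(X, X̂) = 1]` of an informed
adversary; the maximum is over all distributions `Q` on the space of datasets. -/
def IsPriorSuccess {Ω 𝒳 : Type*} [MeasurableSpace Ω] (P : Measure Ω) (X : Ω → 𝒳)
    (ρ : 𝒳 → 𝒳 → Bool) (r : ℝ) : Prop :=
  IsGreatest (Set.range (blindSuccess P X ρ)) r

/-- `1 - δ_A = Pr[ρ(X, A(Y)) = 1]`: success rate of the (possibly randomized) adversary `A`, who
observes `Y` and outputs a dataset drawn from the distribution `A Y`. -/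
def attackSuccess {Ω 𝒳 𝒴 : Type*} [MeasurableSpace Ω] (P : Measure Ω) (X : Ω → 𝒳) (Y : Ω → 𝒴)
    (ρ : 𝒳 → 𝒳 → Bool) (A : 𝒴 → PMF 𝒳) : ℝ :=
  ∫ ω, ((A (Y ω)).toOuterMeasure {x' | ρ (X ω) x' = true}).toReal ∂P

/-- The membership-inference criterion for the record `i`: the guessed dataset is right about
whether `i` belongs to the secret dataset. -/
def miaCriterion {N : ℕ} (i : Fin N) (X X' : Finset (Fin N)) : Bool :=
  decide (i ∈ X ↔ i ∈ X')

/-- Binary Kullback-Leibler divergence in nats (`0 * log 0 = 0`). -/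
def binaryKL (p q : ℝ) : ℝ :=
  p * Real.log (p / q) + (1 - p) * Real.log ((1 - p) / (1 - q))

/-! ### The binary-input Gaussian channel -/

/-- `φ_σ`, the density of the centred Gaussian with standard deviation `σ > 0`. -/
def gaussDensity (σ y : ℝ) : ℝ := gaussianPDFReal 0 (Real.toNNReal (σ ^ 2)) y

/-- Mutual information (in nats) between `ξ ∈ {-1, +1}`, where `P(ξ = +1) = q`, and
`ξ + 𝒩(0, σ²)`. -/
def binaryMI (q σ : ℝ) : ℝ :=
  q * (∫ y, gaussDensity σ (y - 1) * Real.log (gaussDensity σ (y - 1) /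
      (q * gaussDensity σ (y - 1) + (1 - q) * gaussDensity σ (y + 1)))) +
  (1 - q) * (∫ y, gaussDensity σ (y + 1) * Real.log (gaussDensity σ (y + 1) /
      (q * gaussDensity σ (y - 1) + (1 - q) * gaussDensity σ (y + 1))))

/-- The noise level `σ > 0` that solves `binaryMI q σ = β`
(used only for `0 < q < 1` and `0 < β < h(q)`, where the solution exists and is unique). -/
def binaryMIInv (q β : ℝ) : ℝ := sInf {σ : ℝ | 0 < σ ∧ binaryMI q σ = β}

/-! ### The mechanism -/

/-- The sign, with the convention `sign 0 = +1`. -/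
def sgn (x : ℝ) : ℝ := if 0 ≤ x then 1 else -1

/-- Public data of a run of `T` steps in parameter dimension `d`, with universe `Fin N` of records
and `M` candidate subsets. -/
structure Params (N M T d : ℕ) where
  /-- per-sample losses `ℓ_i` -/
  loss : Fin N → EuclideanSpace ℝ (Fin d) → ℝ
  /-- candidate subsets `S_m` -/
  subset : Fin M → Finset (Fin N)
  /-- initial model parameters -/
  θ₀ : EuclideanSpace ℝ (Fin d)
  /-- perturbation scale `μ` -/
  μ : ℝ
  /-- clipping level `c` (`∞` means no clipping) -/
  clip : ℝ≥0∞
  /-- learning rates `η_t` -/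
  η : Fin T → ℝ
  /-- weight decay `λ` -/
  decay : ℝ
  /-- total mutual information budget -/
  budget : ℝ

/-- State before a step: model parameters, posterior over the secret index, and the mutual
information consumed so far. -/
structure State (M d : ℕ) where
  θ : EuclideanSpace ℝ (Fin d)
  p : Fin M → ℝ
  used : ℝ

/-- Randomness of a run: the secret index `j*`, the directions `z_t` and the standardized
Gaussian noises `ν_t`. -/
abbrev Sample (M T d : ℕ) : Type :=
  Fin M × (Fin T → EuclideanSpace ℝ (Fin d)) × (Fin T → ℝ)

/-- `j*` is uniform on the `M` indices, `z_t ∼ 𝒩(0, I_d)` and `ν_t ∼ 𝒩(0, 1)`, all independent. -/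
def sampleMeasure (M T d : ℕ) : Measure (Sample M T d) :=
  (uniformOn (Set.univ : Set (Fin M))).prod
    ((Measure.pi fun _ => stdGaussian (EuclideanSpace ℝ (Fin d))).prod
      (Measure.pi fun _ => gaussianReal 0 1))

variable {N M T d : ℕ}

namespace Params

/-- Two-point finite difference of the `i`-th loss at `θ` in direction `z`. -/
def finiteDiff (C : Params N M T d) (θ z : EuclideanSpace ℝ (Fin d)) (i : Fin N) : ℝ :=
  (C.loss i (θ + C.μ • z) - C.loss i (θ - C.μ • z)) / (2 * C.μ)

/-- Clipped finite difference `sign(ĝ) * min(|ĝ|, c)`. -/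
def clippedDiff (C : Params N M T d) (θ z : EuclideanSpace ℝ (Fin d)) (i : Fin N) : ℝ :=
  sgn (C.finiteDiff θ z i) * (min (ENNReal.ofReal |C.finiteDiff θ z i|) C.clip).toReal

/-- The bit `s_m`: sign of the mean of the clipped differences over the subset `S_m`. -/
def subsetSign (C : Params N M T d) (θ z : EuclideanSpace ℝ (Fin d)) (m : Fin M) : ℝ :=
  sgn ((∑ i ∈ C.subset m, C.clippedDiff θ z i) / ((C.subset m).card : ℝ))

/-- `q_t^+`, the posterior mass of the subsets with sign `+1`. -/
def agreement (C : Params N M T d) (st : State M d) (z : EuclideanSpace ℝ (Fin d)) : ℝ :=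
  ∑ m, if C.subsetSign st.θ z m = 1 then st.p m else 0

/-- Unanimity: the subsets in the support of the posterior agree. -/
def Unanimous (C : Params N M T d) (st : State M d) (z : EuclideanSpace ℝ (Fin d)) : Prop :=
  C.agreement st z = 0 ∨ C.agreement st z = 1

/-- Budget `β_t` of step `t` under adaptive allocation, with the entropy cap. Steps are numbered
from `0`, so `T - t` steps remain. -/
def stepBudget (C : Params N M T d) (t : Fin T) (st : State M d)
    (z : EuclideanSpace ℝ (Fin d)) : ℝ :=
  min (max 0 (C.budget - st.used) / ((T : ℝ) - (t : ℕ)))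
    (0.999 * Real.binEntropy (C.agreement st z))

open Classical in
/-- The noise level `σ_t`: zero on unanimity, calibrated to `β_t` on disagreement. -/
def noiseLevel (C : Params N M T d) (t : Fin T) (st : State M d)
    (z : EuclideanSpace ℝ (Fin d)) : ℝ :=
  if C.Unanimous st z then 0 else binaryMIInv (C.agreement st z) (C.stepBudget t st z)

/-- The internal real-valued release `Ỹ_t = s_{j*} + σ_t ν_t` of a step. -/
def rawRelease (C : Params N M T d) (t : Fin T) (st : State M d)
    (z : EuclideanSpace ℝ (Fin d)) (j : Fin M) (ν : ℝ) : ℝ :=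
  C.subsetSign st.θ z j + C.noiseLevel t st z * ν

open Classical in
/-- The state after a step with direction `z` and internal release `y = Ỹ_t`; the released bit
is `Y_t = sign y`. -/
def next (C : Params N M T d) (t : Fin T) (st : State M d)
    (z : EuclideanSpace ℝ (Fin d)) (y : ℝ) : State M d where
  θ := (1 - C.η t * C.decay) • st.θ - (C.η t * sgn y) • z
  p := fun m =>
    if C.Unanimous st z then st.p m
    else st.p m * gaussDensity (C.noiseLevel t st z) (y - C.subsetSign st.θ z m) /
      ∑ m', st.p m' * gaussDensity (C.noiseLevel t st z) (y - C.subsetSign st.θ z m')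
  used := st.used + if C.Unanimous st z then 0 else C.stepBudget t st z

/-- The initial state: uniform posterior, nothing consumed. -/
def init (C : Params N M T d) : State M d where
  θ := C.θ₀
  p := fun _ => 1 / (M : ℝ)
  used := 0

/-- The state of a run before step `t`. -/
def state (C : Params N M T d) (ω : Sample M T d) (t : Fin (T + 1)) : State M d :=
  Fin.induction (motive := fun _ => State M d) C.init
    (fun t st => C.next t st (ω.2.1 t) (C.rawRelease t st (ω.2.1 t) ω.1 (ω.2.2 t))) t

/-- The released bit `Y_t ∈ {-1, +1}` of step `t`. -/
def release (C : Params N M T d) (ω : Sample M T d) (t : Fin T) : ℝ :=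
  sgn (C.rawRelease t (C.state ω t.castSucc) (ω.2.1 t) ω.1 (ω.2.2 t))

/-- The secret dataset `S* = S_{j*}`. -/
def secret (C : Params N M T d) (ω : Sample M T d) : Finset (Fin N) := C.subset ω.1

/-- What the adversary observes: the public directions `z_{1:T}` and the releases `Y_{1:T}`. -/
def observation (C : Params N M T d) (ω : Sample M T d) :
    (Fin T → EuclideanSpace ℝ (Fin d)) × (Fin T → ℝ) :=
  (ω.2.1, C.release ω)

/-- Balanced subset construction: each record lies in exactly `M / 2` of the `M` subsets. -/
def Balanced (C : Params N M T d) : Prop :=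
  ∀ i : Fin N, 2 * (Finset.univ.filter fun m => i ∈ C.subset m).card = M

end Params

end PACZero

end

open Filter Topology

noncomputable section

namespace PACZero

/-! ### The binary-input Gaussian channel -/

/-! `binaryKL a (1 / 2)` is the supremum over `t` of `t * a - log ((1 + exp t) / 2)`, so it suffices
to bound each of these expressions by the budget when `a` is the success rate (`binaryKL_half_le`).
They are affine in `a`, so the bound can be proved for fixed directions and then averaged; the
mutual information of the whole transcript is never needed.

Fix `z` and `t`, and let `G m y` be `t` times the adversary's chance of being right when the secret
is `S_m` and the internal real-valued releases are `y`. By Gibbs' inequality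
(`sum_mul_le_relEntropyUniform_add_log`), the mean of `G` under any positive posterior `p` is at
most the relative entropy of `p` plus the logarithm of the uniform mean of `exp G`. Convexity of
`exp` and balance, which makes the success chances average to `1 / 2`, bound the second term by `log
((1 + exp t) / 2)`.

A Bayesian update raises the expected relative entropy by the mutual information of the release,
which is exactly the amount charged to the budget (`sum_mul_integral_le_of_posterior`); a unanimous
step reveals nothing. Backward induction (`sum_mul_continuation_le`) therefore bounds the posterior
mean of the conditional expectation of `G` by a constant plus the unspent budget plus the current
relative entropy. Initially the relative entropy is zero and the whole budget is unspent. Since `G`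
may be any bounded measurable function of the internal releases, keeping only their signs costs
nothing.

The analytic part shows that the calibrated noise exists and is measurable: `binaryMI q` is
continuous on the positive axis, with limit the entropy at `0` and limit `0` at infinity. -/

theorem gaussDensity_sub (σ s y : ℝ) :
    gaussDensity σ (y - s) = gaussianPDFReal s (Real.toNNReal (σ ^ 2)) y := by
  simp [gaussDensity, gaussianPDFReal]

theorem toNNReal_sq_ne_zero {σ : ℝ} (hσ : 0 < σ) : Real.toNNReal (σ ^ 2) ≠ 0 := by
  have : 0 < σ ^ 2 := by positivity
  simpa using this.ne'

theorem gaussDensity_pos {σ : ℝ} (hσ : 0 < σ) (y : ℝ) : 0 < gaussDensity σ y :=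
  gaussianPDFReal_pos _ _ _ (toNNReal_sq_ne_zero hσ)

theorem _root_.Measurable.gaussDensity {Ω : Type*} [MeasurableSpace Ω] {f g : Ω → ℝ}
    (hf : Measurable f) (hg : Measurable g) : Measurable fun ω => gaussDensity (f ω) (g ω) := by
  unfold PACZero.gaussDensity gaussianPDFReal
  fun_prop

theorem map_affine_gaussianReal (σ s : ℝ) :
    (gaussianReal 0 1).map (fun x => s + σ * x) = gaussianReal s (Real.toNNReal (σ ^ 2)) := by
  have h1 : (fun x : ℝ => s + σ * x) = (fun x => s + x) ∘ (fun x => σ * x) := rfl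
  rw [h1, ← Measure.map_map (by fun_prop) (by fun_prop), gaussianReal_map_const_mul,
    gaussianReal_map_const_add]
  congr 1
  · simp
  · ext; simp [Real.coe_toNNReal _ (sq_nonneg σ)]

theorem measurableEmbedding_affine {σ : ℝ} (hσ : 0 < σ) (s : ℝ) :
    MeasurableEmbedding (fun x : ℝ => s + σ * x) :=
  (measurableEmbedding_addLeft s).comp (measurableEmbedding_mulLeft₀ hσ.ne')

theorem integral_gaussDensity_mul {σ : ℝ} (hσ : 0 < σ) (s : ℝ) (H : ℝ → ℝ) :
    ∫ y, gaussDensity σ (y - s) * H y = ∫ x, H (s + σ * x) ∂gaussianReal 0 1 := by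
  rw [← (measurableEmbedding_affine hσ s).integral_map, map_affine_gaussianReal,
    integral_gaussianReal_eq_integral_smul (toNNReal_sq_ne_zero hσ)]
  simp [gaussDensity_sub]

theorem integrable_gaussDensity_mul {σ : ℝ} (hσ : 0 < σ) (s : ℝ) {H : ℝ → ℝ}
    (hH : Integrable (fun x => H (s + σ * x)) (gaussianReal 0 1)) :
    Integrable fun y => gaussDensity σ (y - s) * H y := by
  have h : Integrable H (gaussianReal s (Real.toNNReal (σ ^ 2))) := by
    rw [← map_affine_gaussianReal, (measurableEmbedding_affine hσ s).integrable_map_iff]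
    exact hH
  rw [gaussianReal_of_var_ne_zero _ (toNNReal_sq_ne_zero hσ),
    integrable_withDensity_iff (measurable_gaussianPDF _ _)
      (ae_of_all _ fun _ => gaussianPDF_lt_top)] at h
  refine h.congr (ae_of_all _ fun y => ?_)
  simp only [gaussDensity_sub, toReal_gaussianPDF]
  ring

theorem gaussDensity_ratio {σ : ℝ} (hσ : 0 < σ) (s x : ℝ) :
    gaussDensity σ (s + σ * x + s) =
      gaussDensity σ (s + σ * x - s) * Real.exp (-2 * (s * σ⁻¹) ^ 2 - 2 * (s * σ⁻¹) * x) := by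
  have h0 : ((Real.toNNReal (σ ^ 2) : NNReal) : ℝ) = σ ^ 2 := Real.coe_toNNReal _ (sq_nonneg σ)
  simp only [gaussDensity, gaussianPDFReal, h0]
  rw [mul_assoc _ (Real.exp _), ← Real.exp_add]
  congr 2
  field_simp
  ring

/-- Expected log-likelihood ratio between the transmitted symbol, of prior weight `r`, and the
output, at signal-to-noise amplitude `u`. -/
def symbolInfo (r u : ℝ) : ℝ :=
  ∫ x, -Real.log (r + (1 - r) * Real.exp (-2 * u ^ 2 - 2 * u * x)) ∂gaussianReal 0 1

/-- Completing the square, the exponent is `x ^ 2 / 2 - (2 * u + x) ^ 2 / 2`. The resulting bound is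
free of `u`, so it dominates both in the continuity proof and in the limit. -/
theorem abs_log_mixture_le {r : ℝ} (h0 : 0 < r) (h1 : r < 1) (u x : ℝ) :
    |Real.log (r + (1 - r) * Real.exp (-2 * u ^ 2 - 2 * u * x))| ≤ -Real.log r + x ^ 2 / 2 := by
  have hW : Real.exp (-2 * u ^ 2 - 2 * u * x) ≤ Real.exp (x ^ 2 / 2) :=
    Real.exp_le_exp.2 (by nlinarith [sq_nonneg (2 * u + x)])
  have h1W : 1 ≤ Real.exp (x ^ 2 / 2) := Real.one_le_exp (by positivity)
  have hpos := Real.exp_pos (-2 * u ^ 2 - 2 * u * x)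
  have hlr : Real.log r ≤ 0 := Real.log_nonpos h0.le h1.le
  rw [abs_le]
  constructor
  · have : Real.log r ≤ Real.log (r + (1 - r) * Real.exp (-2 * u ^ 2 - 2 * u * x)) :=
      Real.log_le_log h0 (by nlinarith)
    nlinarith [sq_nonneg x]
  · have : Real.log (r + (1 - r) * Real.exp (-2 * u ^ 2 - 2 * u * x)) ≤
        Real.log (Real.exp (x ^ 2 / 2)) :=
      Real.log_le_log (by nlinarith) (by nlinarith)
    rw [Real.log_exp] at this
    linarith

theorem integrable_log_mixture_bound (r : ℝ) :
    Integrable (fun x : ℝ => -Real.log r + x ^ 2 / 2) (gaussianReal 0 1) := by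
  have h := (memLp_id_gaussianReal (μ := 0) (v := 1) 2).integrable_sq
  exact (integrable_const _).add (h.div_const 2)

theorem integrable_log_mixture {r : ℝ} (h0 : 0 < r) (h1 : r < 1) (u : ℝ) :
    Integrable (fun x => Real.log (r + (1 - r) * Real.exp (-2 * u ^ 2 - 2 * u * x)))
      (gaussianReal 0 1) :=
  (integrable_log_mixture_bound r).mono'
    (Measurable.aestronglyMeasurable (by fun_prop)) (ae_of_all _ (abs_log_mixture_le h0 h1 u))

theorem continuous_symbolInfo {r : ℝ} (h0 : 0 < r) (h1 : r < 1) :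
    Continuous (symbolInfo r) := by
  refine continuous_of_dominated
    (fun u => (Measurable.aestronglyMeasurable (by fun_prop)))
    (fun u => ae_of_all _ fun x => ?_) (integrable_log_mixture_bound r) (ae_of_all _ fun x => ?_)
  · rw [norm_neg]; exact abs_log_mixture_le h0 h1 u x
  · refine Continuous.neg (Continuous.log (by fun_prop) fun u => ?_)
    have := Real.exp_pos (-2 * u ^ 2 - 2 * u * x)
    nlinarith

theorem symbolInfo_zero (r : ℝ) : symbolInfo r 0 = 0 := by
  simp [symbolInfo]

/-- As the signal dominates, the wrong symbol's likelihood ratio tends to `0` and the full surprisal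
`-log r` is gained. The filter is general because the two symbols need `atTop` and `atBot`. -/
theorem tendsto_symbolInfo {r : ℝ} (h0 : 0 < r) (h1 : r < 1) {l : Filter ℝ}
    [l.IsCountablyGenerated] (hl : Tendsto (fun u : ℝ => |u|) l atTop) :
    Tendsto (symbolInfo r) l (𝓝 (-Real.log r)) := by
  have hc : -Real.log r = ∫ _ : ℝ, -Real.log r ∂gaussianReal 0 1 := by simp
  rw [hc]
  refine tendsto_integral_filter_of_dominated_convergence _
    (Eventually.of_forall fun u => Measurable.aestronglyMeasurable (by fun_prop))
    (Eventually.of_forall fun u => ae_of_all _ fun x => ?_)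
    (integrable_log_mixture_bound r) (ae_of_all _ fun x => ?_)
  · rw [norm_neg]; exact abs_log_mixture_le h0 h1 u x
  · have hbot : Tendsto (fun u : ℝ => -2 * u ^ 2 - 2 * u * x) l atBot := by
      have hq : Tendsto (fun u : ℝ => -|u| ^ 2 + x ^ 2) l atBot :=
        tendsto_atBot_add_const_right _ _
          (tendsto_neg_atTop_atBot.comp ((tendsto_pow_atTop two_ne_zero).comp hl))
      refine tendsto_atBot_mono (fun u => ?_) hq
      rw [sq_abs]
      nlinarith [sq_nonneg (u + x)]
    have h := ((Real.tendsto_exp_atBot.comp hbot).const_mul (1 - r)).const_add r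
    simp only [mul_zero, add_zero] at h
    exact (h.log h0.ne').neg

theorem measurable_symbolInfo : Measurable fun x : ℝ × ℝ => symbolInfo x.1 x.2 := by
  have h : Measurable fun x : (ℝ × ℝ) × ℝ =>
      -Real.log (x.1.1 + (1 - x.1.1) * Real.exp (-2 * x.1.2 ^ 2 - 2 * x.1.2 * x.2)) := by
    fun_prop
  exact (h.stronglyMeasurable.integral_prod_right).measurable

theorem log_density_ratio {σ : ℝ} (hσ : 0 < σ) (s : ℝ) {r : ℝ} (h0 : 0 < r) (h1 : r < 1)
    (x : ℝ) :
    Real.log (gaussDensity σ (s + σ * x - s) /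
      (r * gaussDensity σ (s + σ * x - s) + (1 - r) * gaussDensity σ (s + σ * x + s))) =
    -Real.log (r + (1 - r) * Real.exp (-2 * (s * σ⁻¹) ^ 2 - 2 * (s * σ⁻¹) * x)) := by
  have hp := gaussDensity_pos hσ (s + σ * x - s)
  rw [gaussDensity_ratio hσ, ← Real.log_inv]
  have hE := Real.exp_pos (-2 * (s * σ⁻¹) ^ 2 - 2 * (s * σ⁻¹) * x)
  generalize Real.exp (-2 * (s * σ⁻¹) ^ 2 - 2 * (s * σ⁻¹) * x) = E at *
  generalize gaussDensity σ (s + σ * x - s) = g at *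
  congr 1
  have : 0 < r + (1 - r) * E := by nlinarith
  rw [show r * g + (1 - r) * (g * E) = g * (r + (1 - r) * E) by ring, div_mul_eq_div_div,
    div_self hp.ne', one_div]

/-- The substitutions `y = ±1 + σ * x` move both integrals to the standard Gaussian; the symbol `-1`
has weight `1 - q` and amplitude `-σ⁻¹`. -/
theorem binaryMI_eq {q σ : ℝ} (h0 : 0 < q) (h1 : q < 1) (hσ : 0 < σ) :
    binaryMI q σ = q * symbolInfo q σ⁻¹ + (1 - q) * symbolInfo (1 - q) (-σ⁻¹) := by
  unfold binaryMI
  congr 2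
  · rw [integral_gaussDensity_mul hσ 1 fun y => Real.log (gaussDensity σ (y - 1) /
      (q * gaussDensity σ (y - 1) + (1 - q) * gaussDensity σ (y + 1)))]
    refine integral_congr_ae (ae_of_all _ fun x => ?_)
    simpa using log_density_ratio hσ 1 h0 h1 x
  · have := integral_gaussDensity_mul hσ (-1) fun y => Real.log (gaussDensity σ (y + 1) /
      (q * gaussDensity σ (y - 1) + (1 - q) * gaussDensity σ (y + 1)))
    simp only [sub_neg_eq_add] at this
    rw [this]
    refine integral_congr_ae (ae_of_all _ fun x => ?_)
    have h := log_density_ratio hσ (-1) (r := 1 - q) (by linarith)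
      (by linarith) x
    simp only [sub_neg_eq_add, sub_sub_cancel, neg_one_mul, ← sub_eq_add_neg] at h
    simp only
    rw [sub_sub_cancel, ← h, add_comm (q * _)]

theorem continuousOn_binaryMI {q : ℝ} (h0 : 0 < q) (h1 : q < 1) :
    ContinuousOn (binaryMI q) (Set.Ioi 0) := by
  have hi : ContinuousOn (fun σ : ℝ => σ⁻¹) (Set.Ioi 0) :=
    continuousOn_inv₀.mono fun x hx => ne_of_gt hx
  refine ContinuousOn.congr ?_ fun σ hσ => binaryMI_eq h0 h1 hσ
  exact (continuousOn_const.mul ((continuous_symbolInfo h0 h1).comp_continuousOn hi)).add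
    (continuousOn_const.mul
      ((continuous_symbolInfo (by linarith) (by linarith)).comp_continuousOn hi.neg))

theorem tendsto_binaryMI_zero {q : ℝ} (h0 : 0 < q) (h1 : q < 1) :
    Tendsto (binaryMI q) (𝓝[>] 0) (𝓝 (Real.binEntropy q)) := by
  have hinv : Tendsto (fun σ : ℝ => |σ⁻¹|) (𝓝[>] 0) atTop :=
    tendsto_abs_atTop_atTop.comp tendsto_inv_nhdsGT_zero
  have ha : Tendsto (fun σ : ℝ => symbolInfo q σ⁻¹) (𝓝[>] 0) (𝓝 (-Real.log q)) :=
    (tendsto_symbolInfo h0 h1 (l := atTop) tendsto_abs_atTop_atTop).comp tendsto_inv_nhdsGT_zero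
  have hb : Tendsto (fun σ : ℝ => symbolInfo (1 - q) (-σ⁻¹)) (𝓝[>] 0)
      (𝓝 (-Real.log (1 - q))) :=
    (tendsto_symbolInfo (by linarith) (by linarith) (l := atBot)
      tendsto_abs_atBot_atTop).comp (tendsto_neg_atTop_atBot.comp tendsto_inv_nhdsGT_zero)
  have h := (ha.const_mul q).add (hb.const_mul (1 - q))
  have he : Real.binEntropy q = q * -Real.log q + (1 - q) * -Real.log (1 - q) := by
    simp [Real.binEntropy]
  rw [he]
  refine h.congr' ?_
  filter_upwards [self_mem_nhdsWithin] with σ hσ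
  exact (binaryMI_eq h0 h1 hσ).symm

theorem tendsto_binaryMI_atTop {q : ℝ} (h0 : 0 < q) (h1 : q < 1) :
    Tendsto (binaryMI q) atTop (𝓝 0) := by
  have ha : Tendsto (fun σ : ℝ => symbolInfo q σ⁻¹) atTop (𝓝 (symbolInfo q 0)) :=
    ((continuous_symbolInfo h0 h1).tendsto 0).comp tendsto_inv_atTop_zero
  have hb : Tendsto (fun σ : ℝ => symbolInfo (1 - q) (-σ⁻¹)) atTop
      (𝓝 (symbolInfo (1 - q) 0)) := by
    have hn : Tendsto (fun σ : ℝ => -σ⁻¹) atTop (𝓝 0) := by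
      simpa using (tendsto_inv_atTop_zero (𝕜 := ℝ)).neg
    exact ((continuous_symbolInfo (r := 1 - q) (by linarith) (by linarith)).tendsto 0).comp hn
  have h := (ha.const_mul q).add (hb.const_mul (1 - q))
  simp only [symbolInfo_zero, mul_zero, add_zero] at h
  refine h.congr' ?_
  filter_upwards [eventually_gt_atTop 0] with σ hσ
  exact (binaryMI_eq h0 h1 hσ).symm

/-! ### First crossing of a level -/

section Crossing

variable {f : ℝ → ℝ} {a β : ℝ}

theorem exists_pos_eq_of_tendsto (hc : ContinuousOn f (Set.Ioi 0))
    (h0 : Tendsto f (𝓝[>] 0) (𝓝 a)) (ha : β < a) {s : ℝ} (hs : 0 < s) (hfs : f s ≤ β) :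
    ∃ σ, 0 < σ ∧ σ ≤ s ∧ f σ = β := by
  obtain ⟨τ, ⟨hτ, hτs⟩, hτ0⟩ :=
    (((h0.eventually (lt_mem_nhds ha)).and
      (mem_nhdsWithin_of_mem_nhds (Iio_mem_nhds hs))).and self_mem_nhdsWithin).exists
  have hτs' : τ ≤ s := le_of_lt hτs
  obtain ⟨σ, hσ, h⟩ := intermediate_value_Icc' hτs'
    (hc.mono fun x hx => lt_of_lt_of_le hτ0 hx.1) ⟨hfs, hτ.le⟩
  exact ⟨σ, lt_of_lt_of_le hτ0 hσ.1, hσ.2, h⟩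

theorem exists_pos_forall_lt (h0 : Tendsto f (𝓝[>] 0) (𝓝 a)) (ha : β < a) :
    ∃ δ, 0 < δ ∧ ∀ σ, 0 < σ → σ < δ → β < f σ := by
  have h := h0.eventually (lt_mem_nhds ha)
  rw [eventually_nhdsWithin_iff, Metric.eventually_nhds_iff] at h
  obtain ⟨δ, hδ, h⟩ := h
  refine ⟨δ, hδ, fun σ hσ hσδ => h ?_ hσ⟩
  rwa [Real.dist_eq, sub_zero, abs_of_pos hσ]

/-- Near `0` the values of `f` exceed `β`, so the solutions form a closed set bounded away from `0`,
where continuity holds. -/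
theorem sInf_crossing_mem (hc : ContinuousOn f (Set.Ioi 0))
    (h0 : Tendsto f (𝓝[>] 0) (𝓝 a)) (ha : β < a) (hne : {σ | 0 < σ ∧ f σ = β}.Nonempty) :
    sInf {σ | 0 < σ ∧ f σ = β} ∈ {σ | 0 < σ ∧ f σ = β} := by
  obtain ⟨δ, hδ, hf⟩ := exists_pos_forall_lt h0 ha
  have hset : {σ | 0 < σ ∧ f σ = β} = Set.Ici δ ∩ f ⁻¹' {β} := by
    ext σ
    constructor
    · rintro ⟨h1, h2⟩
      exact ⟨not_lt.1 fun h => (hf σ h1 h).ne' h2, h2⟩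
    · rintro ⟨h1, h2⟩
      exact ⟨lt_of_lt_of_le hδ h1, h2⟩
  have hclosed : IsClosed {σ | 0 < σ ∧ f σ = β} := by
    rw [hset]
    exact (hc.mono fun x hx => lt_of_lt_of_le hδ hx).preimage_isClosed_of_isClosed
      isClosed_Ici isClosed_singleton
  exact hclosed.csInf_mem hne ⟨0, fun σ hσ => hσ.1.le⟩

/-- Only countably many inequalities at rational points appear on the right. This yields
measurability of the first crossing without monotonicity of `f`. -/
theorem lt_sInf_crossing_iff (hc : ContinuousOn f (Set.Ioi 0))
    (h0 : Tendsto f (𝓝[>] 0) (𝓝 a)) (ha : β < a) (hne : {σ | 0 < σ ∧ f σ = β}.Nonempty)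
    {s : ℝ} (hs : 0 < s) :
    s < sInf {σ | 0 < σ ∧ f σ = β} ↔
      ∃ n : ℕ, ∀ r : ℚ, 0 < (r : ℝ) → (r : ℝ) < s → β + 1 / ((n : ℝ) + 1) ≤ f r := by
  constructor
  · intro hlt
    have hgt : ∀ σ, 0 < σ → σ ≤ s → β < f σ := by
      intro σ hσ hσs
      by_contra! hle
      obtain ⟨τ, hτ, hτσ, hfτ⟩ := exists_pos_eq_of_tendsto hc h0 ha hσ hle
      have := csInf_le ⟨0, fun σ hσ => hσ.1.le⟩
        (show τ ∈ {σ | 0 < σ ∧ f σ = β} from ⟨hτ, hfτ⟩)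
      linarith
    -- A uniform gap above `β`: near `0` it comes from the limit, on the remaining compact interval
    -- from the minimum.
    obtain ⟨b, hβb, hba⟩ := exists_between ha
    obtain ⟨δ, hδ, hf⟩ := exists_pos_forall_lt h0 hba
    have hδ' : 0 < min δ s := lt_min hδ hs
    obtain ⟨τ, hτ, hmin⟩ := isCompact_Icc.exists_isMinOn
      (Set.nonempty_Icc.2 (min_le_right δ s)) (hc.mono fun x hx => lt_of_lt_of_le hδ' hx.1)
    have hτβ := hgt τ (lt_of_lt_of_le hδ' hτ.1) hτ.2
    obtain ⟨n, hn⟩ := exists_nat_one_div_lt (show 0 < min (b - β) (f τ - β) from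
      lt_min (by linarith) (by linarith))
    refine ⟨n, fun r hr hrs => ?_⟩
    rcases lt_or_ge (r : ℝ) δ with h | h
    · have := hf r hr h
      have := min_le_left (b - β) (f τ - β)
      linarith
    · have : f τ ≤ f r := hmin ⟨(min_le_left _ _).trans h, hrs.le⟩
      have := min_le_right (b - β) (f τ - β)
      linarith
  · rintro ⟨n, hn⟩
    have hmem := sInf_crossing_mem hc h0 ha hne
    set τ := sInf {σ | 0 < σ ∧ f σ = β}
    by_contra! hle
    have hpos : 0 < 1 / ((n : ℝ) + 1) := by positivity
    have hcont : ContinuousAt f τ := hc.continuousAt (Ioi_mem_nhds hmem.1)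
    have hev : ∀ᶠ x in 𝓝 τ, f x < β + 1 / ((n : ℝ) + 1) :=
      hcont.eventually (gt_mem_nhds (by rw [hmem.2]; linarith))
    obtain ⟨ε, hε, hball⟩ := Metric.eventually_nhds_iff.1 hev
    -- A rational just left of the crossing violates the gap by continuity; the bound `τ / 2` keeps
    -- it positive.
    obtain ⟨r, hr1, hr2⟩ := exists_rat_btwn
      (show max (τ - ε) (τ / 2) < τ from max_lt (by linarith) (by linarith [hmem.1]))
    have h1 := le_max_left (τ - ε) (τ / 2)
    have h2 := le_max_right (τ - ε) (τ / 2)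
    have h3 := hn r (by linarith [hmem.1]) (by linarith)
    have h4 := hball (y := (r : ℝ)) (by rw [Real.dist_eq, abs_lt]; constructor <;> linarith)
    linarith

end Crossing

/-! ### Existence and measurability of the calibrated noise level. -/

/-- The pairs of a symbol weight and a mutual information that the channel can achieve. -/
def achievable : Set (ℝ × ℝ) :=
  {x | 0 < x.1 ∧ x.1 < 1 ∧ 0 < x.2 ∧ x.2 < Real.binEntropy x.1}

theorem binaryMI_solutions_nonempty {x : ℝ × ℝ} (hx : x ∈ achievable) :
    {σ | 0 < σ ∧ binaryMI x.1 σ = x.2}.Nonempty := by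
  obtain ⟨h0, h1, h2, h3⟩ := hx
  obtain ⟨s, hs, hs0⟩ := (((tendsto_binaryMI_atTop h0 h1).eventually (gt_mem_nhds h2)).and
    (eventually_gt_atTop 0)).exists
  obtain ⟨σ, hσ, -, h⟩ := exists_pos_eq_of_tendsto (continuousOn_binaryMI h0 h1)
    (tendsto_binaryMI_zero h0 h1) h3 hs0 hs.le
  exact ⟨σ, hσ, h⟩

theorem binaryMIInv_spec {x : ℝ × ℝ} (hx : x ∈ achievable) :
    0 < binaryMIInv x.1 x.2 ∧ binaryMI x.1 (binaryMIInv x.1 x.2) = x.2 :=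
  sInf_crossing_mem (continuousOn_binaryMI hx.1 hx.2.1) (tendsto_binaryMI_zero hx.1 hx.2.1)
    hx.2.2.2 (binaryMI_solutions_nonempty hx)

theorem measurableSet_achievable : MeasurableSet achievable := by
  have h : Measurable fun x : ℝ × ℝ => Real.binEntropy x.1 := by fun_prop
  exact ((measurableSet_lt measurable_const measurable_fst).inter
    ((measurableSet_lt measurable_fst measurable_const).inter
      ((measurableSet_lt measurable_const measurable_snd).inter
        (measurableSet_lt measurable_snd h))))

-- The indicator confines the claim to pairs where the infimum is a genuine solution. For a positive
-- threshold the first-crossing criterion applies, with `binaryMI` rewritten through the jointly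
-- measurable `symbolInfo`.
open Classical in
theorem measurable_indicator_binaryMIInv :
    Measurable (achievable.indicator fun x : ℝ × ℝ => binaryMIInv x.1 x.2) := by
  refine measurable_of_Ioi fun s => ?_
  rcases lt_or_ge s 0 with hs | hs
  · convert MeasurableSet.univ
    ext x
    simp only [Set.mem_preimage, Set.mem_Ioi, Set.mem_univ, iff_true, Set.indicator_apply]
    split_ifs with hx
    · exact hs.trans (binaryMIInv_spec hx).1
    · exact hs
  rcases hs.eq_or_lt with rfl | hs
  · convert measurableSet_achievable
    ext x
    simp only [Set.mem_preimage, Set.mem_Ioi, Set.indicator_apply]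
    split_ifs with hx
    · simpa [hx] using (binaryMIInv_spec hx).1
    · simp [hx]
  · have hset : (achievable.indicator fun x : ℝ × ℝ => binaryMIInv x.1 x.2) ⁻¹' Set.Ioi s =
        achievable ∩ ⋃ n : ℕ, ⋂ r : ℚ, {x | 0 < (r : ℝ) → (r : ℝ) < s →
          x.2 + 1 / ((n : ℝ) + 1) ≤
            x.1 * symbolInfo x.1 (r : ℝ)⁻¹ + (1 - x.1) * symbolInfo (1 - x.1) (-(r : ℝ)⁻¹)} := by
      ext x
      simp only [Set.mem_preimage, Set.mem_Ioi, Set.indicator_apply, Set.mem_inter_iff,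
        Set.mem_iUnion, Set.mem_iInter, Set.mem_ofPred_eq]
      split_ifs with hx
      · simp only [hx, true_and]
        refine (lt_sInf_crossing_iff (continuousOn_binaryMI hx.1 hx.2.1)
          (tendsto_binaryMI_zero hx.1 hx.2.1) hx.2.2.2 (binaryMI_solutions_nonempty hx) hs).trans
          ?_
        refine exists_congr fun n => forall_congr' fun r => forall_congr' fun hr => ?_
        rw [binaryMI_eq hx.1 hx.2.1 hr]
      · simp [hx, hs.le]
    rw [hset]
    refine measurableSet_achievable.inter (MeasurableSet.iUnion fun n =>
      MeasurableSet.iInter fun r => ?_)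
    by_cases hr : 0 < (r : ℝ)
    · by_cases hrs : (r : ℝ) < s
      · simp only [hr, hrs, forall_true_left]
        have h1 : Measurable fun x : ℝ × ℝ => symbolInfo x.1 (r : ℝ)⁻¹ :=
          measurable_symbolInfo.comp (measurable_fst.prodMk measurable_const)
        have h2 : Measurable fun x : ℝ × ℝ => symbolInfo (1 - x.1) (-(r : ℝ)⁻¹) :=
          measurable_symbolInfo.comp
            ((measurable_const.sub measurable_fst).prodMk measurable_const)
        exact measurableSet_le (by fun_prop) (by fun_prop)
      · simp [hrs]
    · simp [hr]

/-! ### Bayesian updates and relative entropy -/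

section Bayes

variable {M : ℕ}

/-- Relative entropy of `p` with respect to the uniform distribution on `M` points. -/
def relEntropyUniform (p : Fin M → ℝ) : ℝ := ∑ m, p m * Real.log (M * p m)

/-- Density of the released value under the mixture of the candidates. -/
def mixDensity (p s : Fin M → ℝ) (σ y : ℝ) : ℝ := ∑ m, p m * gaussDensity σ (y - s m)

/-- Probability mass of the candidates with sign `+1`. -/
def plusMass (p s : Fin M → ℝ) : ℝ := ∑ m, if s m = 1 then p m else 0

theorem one_sub_plusMass {p : Fin M → ℝ} (hp1 : ∑ m, p m = 1) (s : Fin M → ℝ) :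
    1 - plusMass p s = ∑ m, if s m = 1 then 0 else p m := by
  rw [sub_eq_iff_eq_add, plusMass, ← Finset.sum_add_distrib, eq_comm]
  refine (Finset.sum_congr rfl fun m _ => ?_).trans hp1
  by_cases h : s m = 1 <;> simp [h]

/-- Reduces the mixture over `M` candidates to a binary-input channel with input weight `plusMass p
s`. -/
theorem sum_eq_plusMass {p s : Fin M → ℝ} (hp1 : ∑ m, p m = 1) (hs : ∀ m, s m = 1 ∨ s m = -1)
    (F : ℝ → ℝ) :
    ∑ m, p m * F (s m) = plusMass p s * F 1 + (1 - plusMass p s) * F (-1) := by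
  rw [one_sub_plusMass hp1, plusMass, Finset.sum_mul, Finset.sum_mul, ← Finset.sum_add_distrib]
  refine Finset.sum_congr rfl fun m _ => ?_
  rcases hs m with h | h
  · simp [h]
  · have : ¬ (-1 : ℝ) = 1 := by norm_num
    simp [h, this]

theorem mixDensity_eq {p s : Fin M → ℝ} (hp1 : ∑ m, p m = 1) (hs : ∀ m, s m = 1 ∨ s m = -1)
    (σ y : ℝ) :
    mixDensity p s σ y =
      plusMass p s * gaussDensity σ (y - 1) + (1 - plusMass p s) * gaussDensity σ (y + 1) := by
  have := sum_eq_plusMass hp1 hs fun x => gaussDensity σ (y - x)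
  rwa [sub_neg_eq_add] at this

theorem mixDensity_pos {p : Fin M → ℝ} (hp : ∀ m, 0 < p m) (hp1 : ∑ m, p m = 1)
    (s : Fin M → ℝ) {σ : ℝ} (hσ : 0 < σ) (y : ℝ) : 0 < mixDensity p s σ y := by
  have hne : (Finset.univ : Finset (Fin M)).Nonempty := by
    by_contra h
    rw [Finset.not_nonempty_iff_eq_empty] at h
    simp [h] at hp1
  exact Finset.sum_pos (fun m _ => mul_pos (hp m) (gaussDensity_pos hσ _)) hne

/-- The log-likelihood ratio of the released value between a candidate sign and the mixture is
integrable. -/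
theorem integrable_log_likelihood {p s : Fin M → ℝ} (hp1 : ∑ m, p m = 1)
    (hs : ∀ m, s m = 1 ∨ s m = -1) {σ : ℝ} (hσ : 0 < σ) (h0 : 0 < plusMass p s)
    (h1 : plusMass p s < 1) (m : Fin M) :
    Integrable (fun x => Real.log (gaussDensity σ (s m + σ * x - s m) /
      mixDensity p s σ (s m + σ * x))) (gaussianReal 0 1) := by
  simp only [mixDensity_eq hp1 hs]
  rcases hs m with h | h
  · rw [h]
    refine (integrable_log_mixture h0 h1 (1 * σ⁻¹)).neg.congr (ae_of_all _ fun x => ?_)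
    exact (log_density_ratio hσ 1 h0 h1 x).symm
  · rw [h]
    refine (integrable_log_mixture (r := 1 - plusMass p s) (by linarith) (by linarith)
      (-1 * σ⁻¹)).neg.congr (ae_of_all _ fun x => ?_)
    have := log_density_ratio hσ (-1) (r := 1 - plusMass p s) (by linarith)
      (by linarith) x
    simp only [Pi.neg_apply]
    rw [← this, sub_sub_cancel, sub_neg_eq_add, ← sub_eq_add_neg, add_comm (plusMass p s * _)]

theorem sum_mul_integral_log_likelihood {p s : Fin M → ℝ} (hp1 : ∑ m, p m = 1)
    (hs : ∀ m, s m = 1 ∨ s m = -1) {σ : ℝ} (hσ : 0 < σ) :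
    ∑ m, p m * ∫ x, Real.log (gaussDensity σ (s m + σ * x - s m) /
      mixDensity p s σ (s m + σ * x)) ∂gaussianReal 0 1 = binaryMI (plusMass p s) σ := by
  have := sum_eq_plusMass hp1 hs fun t => ∫ y, gaussDensity σ (y - t) *
    Real.log (gaussDensity σ (y - t) / mixDensity p s σ y)
  simp only [sub_neg_eq_add, mixDensity_eq hp1 hs] at this
  rw [binaryMI, ← this]
  refine Finset.sum_congr rfl fun m _ => ?_
  rw [integral_gaussDensity_mul hσ]
  simp only [mixDensity_eq hp1 hs]

/-- If after every Bayesian update the posterior mean of `V` is at most the relative entropy of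
the posterior plus `b`, then before it the mean is at most the relative entropy of the prior plus
`b` plus the mutual information of the release. -/
theorem sum_mul_integral_le_of_posterior {p s : Fin M → ℝ} (hM : 0 < M) (hp : ∀ m, 0 < p m)
    (hp1 : ∑ m, p m = 1) (hs : ∀ m, s m = 1 ∨ s m = -1) {σ : ℝ} (hσ : 0 < σ)
    (h0 : 0 < plusMass p s) (h1 : plusMass p s < 1) {V : Fin M → ℝ → ℝ} {b : ℝ}
    (hint : ∀ m, Integrable (fun x => V m (s m + σ * x)) (gaussianReal 0 1))
    (hV : ∀ y, ∑ m, p m * gaussDensity σ (y - s m) / mixDensity p s σ y * V m y ≤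
      b + relEntropyUniform fun m => p m * gaussDensity σ (y - s m) / mixDensity p s σ y) :
    ∑ m, p m * ∫ x, V m (s m + σ * x) ∂gaussianReal 0 1 ≤
      b + relEntropyUniform p + binaryMI (plusMass p s) σ := by
  have hM' : (0 : ℝ) < M := by exact_mod_cast hM
  -- `H` is `V - b` minus the logarithm of `M` times the updated posterior, split into a prior part
  -- and a likelihood part. The mean of the likelihood part is the mutual information.
  let H : Fin M → ℝ → ℝ := fun m y => V m y - (b + Real.log (M * p m)) -
    Real.log (gaussDensity σ (y - s m) / mixDensity p s σ y)
  have hlog := integrable_log_likelihood hp1 hs hσ h0 h1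
  have hH : ∀ m, Integrable (fun x => H m (s m + σ * x)) (gaussianReal 0 1) := fun m =>
    ((hint m).sub (integrable_const _)).sub (hlog m)
  have hsplit : ∀ m, ∫ x, H m (s m + σ * x) ∂gaussianReal 0 1 =
      (∫ x, V m (s m + σ * x) ∂gaussianReal 0 1) - (b + Real.log (M * p m)) -
        ∫ x, Real.log (gaussDensity σ (s m + σ * x - s m) /
          mixDensity p s σ (s m + σ * x)) ∂gaussianReal 0 1 := by
    intro m
    simp only [H]
    rw [integral_sub (f := fun x => V m (s m + σ * x) - (b + Real.log (M * p m)))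
      ((hint m).sub (integrable_const _)) (hlog m),
      integral_sub (hint m) (integrable_const _)]
    simp
  have hle : ∑ m, p m * ∫ x, H m (s m + σ * x) ∂gaussianReal 0 1 ≤ 0 := by
    simp only [← integral_gaussDensity_mul hσ, ← integral_const_mul]
    rw [← integral_finsetSum _ fun m _ => (integrable_gaussDensity_mul hσ _ (hH m)).const_mul _]
    refine integral_nonpos fun y => ?_
    -- For each `y`, the weighted sum of `H` is the mixture density times the difference of the two
    -- sides of `hV`, hence nonpositive.
    have hZ := mixDensity_pos hp hp1 s hσ y
    have hrew : ∀ m, p m * (gaussDensity σ (y - s m) * H m y) = mixDensity p s σ y *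
        (p m * gaussDensity σ (y - s m) / mixDensity p s σ y * V m y -
          b * (p m * gaussDensity σ (y - s m) / mixDensity p s σ y) -
          p m * gaussDensity σ (y - s m) / mixDensity p s σ y *
            Real.log (M * (p m * gaussDensity σ (y - s m) / mixDensity p s σ y))) := by
      intro m
      have hg := gaussDensity_pos hσ (y - s m)
      have : Real.log (M * (p m * gaussDensity σ (y - s m) / mixDensity p s σ y)) =
          Real.log (M * p m) + Real.log (gaussDensity σ (y - s m) / mixDensity p s σ y) := by
        rw [← Real.log_mul (mul_pos hM' (hp m)).ne' (div_pos hg hZ).ne']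
        congr 1
        ring
      rw [this]
      simp only [H]
      field_simp
      ring
    simp only [hrew, ← Finset.mul_sum, Finset.sum_sub_distrib]
    have hsum : ∑ m, p m * gaussDensity σ (y - s m) / mixDensity p s σ y = 1 := by
      rw [← Finset.sum_div]
      exact div_self hZ.ne'
    have := hV y
    rw [relEntropyUniform] at this
    rw [hsum]
    exact mul_nonpos_of_nonneg_of_nonpos hZ.le (by linarith)
  simp only [hsplit, mul_sub, mul_add, Finset.sum_sub_distrib, Finset.sum_add_distrib,
    ← Finset.sum_mul, hp1, sum_mul_integral_log_likelihood hp1 hs hσ] at hle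
  rw [relEntropyUniform]
  linarith

/-- The Gibbs variational inequality on a finite set. -/
theorem sum_mul_le_relEntropyUniform_add_log {p : Fin M → ℝ} (hM : 0 < M) (hp : ∀ m, 0 < p m)
    (hp1 : ∑ m, p m = 1) (g : Fin M → ℝ) :
    ∑ m, p m * g m ≤
      relEntropyUniform p + Real.log ((∑ m, Real.exp (g m)) / M) := by
  have hM' : (0 : ℝ) < M := by exact_mod_cast hM
  have hS : 0 < (∑ m, Real.exp (g m)) / M :=
    div_pos (Finset.sum_pos (fun m _ => Real.exp_pos _) ⟨⟨0, hM⟩, Finset.mem_univ _⟩) hM'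
  set S := (∑ m, Real.exp (g m)) / M with hSdef
  -- This is `log x ≤ x - 1` at the ratio of the Gibbs weight `exp (g m) / (M * S)` to `p m`; the
  -- corrections sum to zero because both weights have total mass `1`.
  have hterm : ∀ m, p m * g m ≤
      p m * Real.log (M * p m) + p m * Real.log S + (Real.exp (g m) / (M * S) - p m) := by
    intro m
    have hpos : 0 < Real.exp (g m) / (M * p m * S) :=
      div_pos (Real.exp_pos _) (mul_pos (mul_pos hM' (hp m)) hS)
    have h := Real.log_le_sub_one_of_pos hpos
    rw [Real.log_div (Real.exp_pos _).ne' (mul_pos (mul_pos hM' (hp m)) hS).ne', Real.log_exp,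
      Real.log_mul (mul_pos hM' (hp m)).ne' hS.ne'] at h
    have h2 := mul_le_mul_of_nonneg_left h (hp m).le
    have h3 : p m * (Real.exp (g m) / (M * p m * S) - 1) = Real.exp (g m) / (M * S) - p m := by
      have := hp m
      field_simp
    rw [h3] at h2
    linarith
  have hsum := Finset.sum_le_sum fun m (_ : m ∈ Finset.univ) => hterm m
  rw [Finset.sum_add_distrib, Finset.sum_add_distrib, Finset.sum_sub_distrib, ← Finset.sum_mul,
    hp1, ← Finset.sum_div] at hsum
  have hone : (∑ m, Real.exp (g m)) / (M * S) = 1 := by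
    rw [div_mul_eq_div_div, ← hSdef, div_self hS.ne']
  rw [relEntropyUniform]
  linarith

end Bayes

/-! ### Binary divergence -/

/-- The convex function lies below its chord on `[0, 1]`; the chord only sees the mean of `g`. -/
theorem exp_mul_le_affine {g : ℝ} (h0 : 0 ≤ g) (h1 : g ≤ 1) (t : ℝ) :
    Real.exp (t * g) ≤ 1 + g * (Real.exp t - 1) := by
  have h := convexOn_exp.2 (Set.mem_univ 0) (Set.mem_univ t) (sub_nonneg.2 h1) h0 (by ring)
  simp only [smul_eq_mul, mul_zero, zero_add, Real.exp_zero] at h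
  rw [mul_comm t g]
  linarith

theorem log_two_le_of_forall {B : ℝ} (h : ∀ t : ℝ, t - Real.log ((1 + Real.exp t) / 2) ≤ B) :
    Real.log 2 ≤ B := by
  refine le_of_forall_pos_le_add fun ε hε => ?_
  -- At this point the hypothesis becomes `log 2 - log (1 + ε) ≤ B`.
  have ht := h (-Real.log ε)
  have he : Real.exp (-Real.log ε) = ε⁻¹ := by rw [Real.exp_neg, Real.exp_log hε]
  have hlog := Real.log_le_sub_one_of_pos (show 0 < 1 + ε by linarith)
  have h2 : (1 + ε⁻¹) / 2 = (1 + ε) / (ε * 2) := by field_simp; ring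
  rw [he, h2, Real.log_div (by positivity) (by positivity), Real.log_mul hε.ne' two_ne_zero] at ht
  linarith

/-- The optimal `t` is the log-odds `log (a / (1 - a))`. At `a = 0` and `a = 1` it is infinite, and
a limit in `t` gives the value `log 2` instead. -/
theorem binaryKL_half_le {a B : ℝ} (h0 : 0 ≤ a) (h1 : a ≤ 1)
    (h : ∀ t : ℝ, t * a - Real.log ((1 + Real.exp t) / 2) ≤ B) : binaryKL a (1 / 2) ≤ B := by
  have hhalf : (1 : ℝ) - 1 / 2 = 1 / 2 := by norm_num
  rcases h0.eq_or_lt with rfl | h0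
  · have : Real.log 2 ≤ B := by
      refine log_two_le_of_forall fun t => ?_
      have := h (-t)
      have he : (1 + Real.exp t) / 2 = Real.exp t * ((1 + Real.exp (-t)) / 2) := by
        rw [Real.exp_neg]
        field_simp
        ring
      rw [he, Real.log_mul (Real.exp_pos t).ne' (by positivity), Real.log_exp]
      linarith
    rw [binaryKL, hhalf]
    simpa using this
  rcases h1.eq_or_lt with rfl | h1
  · have : Real.log 2 ≤ B := log_two_le_of_forall fun t => by simpa using h t
    rw [binaryKL, hhalf]
    simpa using this
  · have h2 : 0 < 1 - a := by linarith
    have ht := h (Real.log (a / (1 - a)))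
    have he : (1 + a / (1 - a)) / 2 = (2 * (1 - a))⁻¹ := by field_simp; ring
    rw [Real.exp_log (div_pos h0 h2), he, Real.log_inv, Real.log_div h0.ne' h2.ne',
      Real.log_mul two_ne_zero h2.ne'] at ht
    rw [binaryKL, hhalf, show a / (1 / 2) = 2 * a by ring,
      show (1 - a) / (1 / 2) = 2 * (1 - a) by ring, Real.log_mul two_ne_zero h0.ne',
      Real.log_mul two_ne_zero h2.ne']
    linarith

/-! ### Signs and the measurable structure on states. -/

variable {N M T d : ℕ}

theorem sgn_eq_or (x : ℝ) : sgn x = 1 ∨ sgn x = -1 := by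
  unfold sgn
  split_ifs <;> simp

theorem measurable_sgn : Measurable sgn :=
  Measurable.ite measurableSet_Ici measurable_const measurable_const

instance : MeasurableSpace (State M d) :=
  MeasurableSpace.comap (fun st => (st.θ, st.p, st.used)) inferInstance

theorem measurable_tuple : Measurable fun st : State M d => (st.θ, st.p, st.used) :=
  comap_measurable _

theorem State.measurable_θ : Measurable (State.θ : State M d → _) := measurable_tuple.fst

theorem State.measurable_p : Measurable (State.p : State M d → _) := measurable_tuple.snd.fst

theorem State.measurable_used : Measurable (State.used : State M d → _) :=
  measurable_tuple.snd.snd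

theorem measurable_state {Ω : Type*} [MeasurableSpace Ω] {f : Ω → State M d}
    (hθ : Measurable fun ω => (f ω).θ) (hp : Measurable fun ω => (f ω).p)
    (hu : Measurable fun ω => (f ω).used) : Measurable f :=
  measurable_comap_iff.2 (hθ.prodMk (hp.prodMk hu))

namespace Params

variable (C : Params N M T d)

/-! ### Invariants of a run -/

/-- The invariants of the states before step `t`: the posterior is a strictly positive
probability vector, and the budget is not exhausted before the end. -/
structure Admissible (t : Fin (T + 1)) (st : State M d) : Prop where
  pos : ∀ m, 0 < st.p m
  sum_eq_one : ∑ m, st.p m = 1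
  used_le : st.used ≤ C.budget
  used_lt : t ≠ Fin.last T → st.used < C.budget

theorem subsetSign_eq_or (θ z : EuclideanSpace ℝ (Fin d)) (m : Fin M) :
    C.subsetSign θ z m = 1 ∨ C.subsetSign θ z m = -1 := sgn_eq_or _

variable {C}

theorem agreement_eq_plusMass (st : State M d) (z : EuclideanSpace ℝ (Fin d)) :
    C.agreement st z = plusMass st.p (C.subsetSign st.θ z) := rfl

variable {t : Fin T} {st : State M d}

theorem agreement_pos_lt_one (h : C.Admissible t.castSucc st) {z : EuclideanSpace ℝ (Fin d)}
    (hu : ¬ C.Unanimous st z) : 0 < C.agreement st z ∧ C.agreement st z < 1 := by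
  rw [Unanimous, not_or] at hu
  constructor
  · refine lt_of_le_of_ne (Finset.sum_nonneg fun m _ => ?_) (Ne.symm hu.1)
    split_ifs
    · exact (h.pos m).le
    · exact le_rfl
  · refine lt_of_le_of_ne (sub_nonneg.1 ?_) hu.2
    rw [agreement_eq_plusMass, one_sub_plusMass h.sum_eq_one]
    refine Finset.sum_nonneg fun m _ => ?_
    split_ifs
    · exact le_rfl
    · exact (h.pos m).le

/-- Every candidate has positive posterior weight, so a mass of `0` or `1` leaves no dissenting
candidate. -/
theorem subsetSign_eq_of_unanimous (h : C.Admissible t.castSucc st)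
    {z : EuclideanSpace ℝ (Fin d)} (hu : C.Unanimous st z) (m m' : Fin M) :
    C.subsetSign st.θ z m = C.subsetSign st.θ z m' := by
  rcases hu with hu | hu
  · have hne : ∀ m, C.subsetSign st.θ z m ≠ 1 := by
      intro m hm
      have h0 := (Finset.sum_eq_zero_iff_of_nonneg (fun m _ => by
        split_ifs
        · exact (h.pos m).le
        · exact le_rfl)).1 hu m (Finset.mem_univ m)
      rw [if_pos hm] at h0
      exact (h.pos m).ne' h0
    rw [(C.subsetSign_eq_or st.θ z m).resolve_left (hne m),
      (C.subsetSign_eq_or st.θ z m').resolve_left (hne m')]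
  · have heq : ∀ m, C.subsetSign st.θ z m = 1 := by
      intro m
      by_contra hm
      have hz := one_sub_plusMass h.sum_eq_one (C.subsetSign st.θ z)
      rw [← agreement_eq_plusMass, hu, sub_self] at hz
      have h0 := (Finset.sum_eq_zero_iff_of_nonneg (fun m _ => by
        split_ifs
        · exact le_rfl
        · exact (h.pos m).le)).1 hz.symm m (Finset.mem_univ m)
      rw [if_neg hm] at h0
      exact (h.pos m).ne' h0
    rw [heq, heq]

theorem one_le_remaining (t : Fin T) : (1 : ℝ) ≤ (T : ℝ) - (t : ℕ) := by
  have : ((t : ℕ) : ℝ) + 1 ≤ T := by exact_mod_cast t.2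
  linarith

/-- Strictly unspent budget makes `β_t` positive; the factor `0.999` keeps it strictly below the
entropy. -/
theorem achievable_of_not_unanimous (h : C.Admissible t.castSucc st)
    {z : EuclideanSpace ℝ (Fin d)} (hu : ¬ C.Unanimous st z) :
    (C.agreement st z, C.stepBudget t st z) ∈ achievable := by
  obtain ⟨h0, h1⟩ := agreement_pos_lt_one h hu
  have hH := Real.binEntropy_pos h0 h1
  have hB := h.used_lt (Fin.castSucc_lt_last t).ne
  refine ⟨h0, h1, lt_min (div_pos (lt_max_of_lt_right (by linarith))
    (by linarith [one_le_remaining t])) (by positivity), ?_⟩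
  exact (min_le_right _ _).trans_lt (by simp only; linarith)

theorem noiseLevel_spec (h : C.Admissible t.castSucc st)
    {z : EuclideanSpace ℝ (Fin d)} (hu : ¬ C.Unanimous st z) :
    0 < C.noiseLevel t st z ∧
      binaryMI (C.agreement st z) (C.noiseLevel t st z) = C.stepBudget t st z := by
  rw [noiseLevel, if_neg hu]
  exact binaryMIInv_spec (achievable_of_not_unanimous h hu)

theorem next_p_of_not_unanimous {z : EuclideanSpace ℝ (Fin d)} (hu : ¬ C.Unanimous st z) (y : ℝ) :
    (C.next t st z y).p = fun m => st.p m * gaussDensity (C.noiseLevel t st z)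
      (y - C.subsetSign st.θ z m) /
        mixDensity st.p (C.subsetSign st.θ z) (C.noiseLevel t st z) y := by
  simp only [next, if_neg hu, mixDensity]

theorem next_p_of_unanimous {z : EuclideanSpace ℝ (Fin d)} (hu : C.Unanimous st z) (y : ℝ) :
    (C.next t st z y).p = st.p := by
  simp only [next, if_pos hu]

theorem next_used_of_not_unanimous {z : EuclideanSpace ℝ (Fin d)} (hu : ¬ C.Unanimous st z)
    (y : ℝ) : (C.next t st z y).used = st.used + C.stepBudget t st z := by
  simp only [next, if_neg hu]

theorem next_used_of_unanimous {z : EuclideanSpace ℝ (Fin d)} (hu : C.Unanimous st z) (y : ℝ) :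
    (C.next t st z y).used = st.used := by
  simp only [next, if_pos hu, add_zero]

theorem Admissible.next (h : C.Admissible t.castSucc st) (z : EuclideanSpace ℝ (Fin d)) (y : ℝ) :
    C.Admissible t.succ (C.next t st z y) := by
  have hB := h.used_lt (Fin.castSucc_lt_last t).ne
  by_cases hu : C.Unanimous st z
  · have hused := next_used_of_unanimous (t := t) hu y
    refine ⟨?_, ?_, ?_, ?_⟩
    · rw [next_p_of_unanimous hu]; exact h.pos
    · rw [next_p_of_unanimous hu]; exact h.sum_eq_one
    · rw [hused]; exact h.used_le
    · rw [hused]; exact fun _ => hB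
  · have hused := next_used_of_not_unanimous (t := t) hu y
    have hσ := (noiseLevel_spec h hu).1
    have hZ := mixDensity_pos h.pos h.sum_eq_one (C.subsetSign st.θ z) hσ y
    have hr := one_le_remaining t
    have hβ : C.stepBudget t st z ≤ (C.budget - st.used) / ((T : ℝ) - (t : ℕ)) := by
      refine (min_le_left _ _).trans ?_
      rw [max_eq_right (by linarith)]
    refine ⟨?_, ?_, ?_, ?_⟩
    · rw [next_p_of_not_unanimous hu]
      exact fun m => div_pos (mul_pos (h.pos m) (gaussDensity_pos hσ _)) hZ
    · rw [next_p_of_not_unanimous hu, ← Finset.sum_div]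
      exact div_self hZ.ne'
    · have : (C.budget - st.used) / ((T : ℝ) - (t : ℕ)) ≤ C.budget - st.used :=
        div_le_self (by linarith) hr
      rw [hused]
      linarith
    · intro hlast
      -- At least two steps remain, so the share spent now is strictly less than what is left.
      have ht : (t : ℕ) + 1 < T := by
        by_contra hge
        exact hlast (Fin.ext (by simp; omega))
      have ht' : ((t : ℕ) : ℝ) + 1 < T := by exact_mod_cast ht
      have : (C.budget - st.used) / ((T : ℝ) - (t : ℕ)) < C.budget - st.used :=
        div_lt_self (by linarith) (by linarith)
      rw [hused]
      linarith

theorem admissible_init (hM : 0 < M) (hB : 0 < C.budget) : C.Admissible 0 C.init := by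
  have hM' : (0 : ℝ) < M := by exact_mod_cast hM
  refine ⟨fun m => by simp only [init]; positivity, ?_, hB.le, fun _ => hB⟩
  simp [init, hM'.ne']

/-! ### The run as a function of its internal releases -/

variable (C) in
/-- The state before step `t` of a run with directions `z` and internal releases `y`. -/
def stateOf (z : Fin T → EuclideanSpace ℝ (Fin d)) (y : Fin T → ℝ) (t : Fin (T + 1)) :
    State M d :=
  Fin.induction (motive := fun _ => State M d) C.init
    (fun t st => C.next t st (z t) (y t)) t

variable (C) in
/-- The internal real-valued release of step `t`. -/
def internalRelease (ω : Sample M T d) (t : Fin T) : ℝ :=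
  C.rawRelease t (C.state ω t.castSucc) (ω.2.1 t) ω.1 (ω.2.2 t)

theorem state_zero (ω : Sample M T d) : C.state ω 0 = C.init := rfl

theorem stateOf_zero (z : Fin T → EuclideanSpace ℝ (Fin d)) (y : Fin T → ℝ) :
    C.stateOf z y 0 = C.init := rfl

theorem state_succ (ω : Sample M T d) (t : Fin T) :
    C.state ω t.succ = C.next t (C.state ω t.castSucc) (ω.2.1 t) (C.internalRelease ω t) := rfl

theorem stateOf_succ (z : Fin T → EuclideanSpace ℝ (Fin d)) (y : Fin T → ℝ) (t : Fin T) :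
    C.stateOf z y t.succ = C.next t (C.stateOf z y t.castSucc) (z t) (y t) := rfl

/-- The secret index and the noises affect the state only through the internal releases, so the
posterior is a function of directions and releases. -/
theorem state_eq_stateOf (ω : Sample M T d) (t : Fin (T + 1)) :
    C.state ω t = C.stateOf ω.2.1 (C.internalRelease ω) t := by
  induction t using Fin.induction with
  | zero => rw [state_zero, stateOf_zero]
  | succ t ih => rw [state_succ, stateOf_succ, ih]

theorem stateOf_congr (z : Fin T → EuclideanSpace ℝ (Fin d)) {y y' : Fin T → ℝ}
    (t : Fin (T + 1)) (h : ∀ s : Fin T, s.castSucc < t → y s = y' s) :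
    C.stateOf z y t = C.stateOf z y' t := by
  induction t using Fin.induction with
  | zero => rw [stateOf_zero, stateOf_zero]
  | succ t ih =>
    rw [stateOf_succ, stateOf_succ,
      ih fun s hs => h s (hs.trans Fin.castSucc_lt_succ), h t Fin.castSucc_lt_succ]

/-- The invariants hold for every real sequence `y`, so no null sets have to be excluded later. -/
theorem admissible_stateOf (hM : 0 < M) (hB : 0 < C.budget)
    (z : Fin T → EuclideanSpace ℝ (Fin d)) (y : Fin T → ℝ) (t : Fin (T + 1)) :
    C.Admissible t (C.stateOf z y t) := by
  induction t using Fin.induction with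
  | zero => exact admissible_init hM hB
  | succ t ih => exact ih.next _ _

/-- The state before step `t` does not depend on the noises of step `t` and later. -/
theorem state_update_noise (j : Fin M) (z : Fin T → EuclideanSpace ℝ (Fin d)) (ν : Fin T → ℝ)
    (s : Fin T) (x : ℝ) (t : Fin (T + 1)) (h : t ≤ s.castSucc) :
    C.state (j, z, Function.update ν s x) t = C.state (j, z, ν) t := by
  induction t using Fin.induction with
  | zero => rw [state_zero, state_zero]
  | succ t ih =>
    have hts : t ≠ s := by
      rintro rfl
      exact absurd h (not_le.2 Fin.castSucc_lt_succ)
    rw [state_succ, state_succ, internalRelease, internalRelease,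
      ih (Fin.castSucc_lt_succ.le.trans h)]
    simp [hts]

/-! ### Measurability of a run -/

section Measurability

variable {Ω : Type*} [MeasurableSpace Ω] {f : Ω → State M d} {z : Ω → EuclideanSpace ℝ (Fin d)}
  {y : Ω → ℝ}

theorem measurable_subsetSign (hloss : ∀ i, Measurable (C.loss i)) (hf : Measurable f)
    (hz : Measurable z) (m : Fin M) : Measurable fun ω => C.subsetSign (f ω).θ (z ω) m := by
  have hθ : Measurable fun ω => (f ω).θ := State.measurable_θ.comp hf
  have hfd : ∀ i, Measurable fun ω => C.finiteDiff (f ω).θ (z ω) i := fun i =>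
    (((hloss i).comp (hθ.add (hz.const_smul C.μ))).sub
      ((hloss i).comp (hθ.sub (hz.const_smul C.μ)))).div_const _
  have hcl : ∀ i, Measurable fun ω => C.clippedDiff (f ω).θ (z ω) i := fun i =>
    (measurable_sgn.comp (hfd i)).mul
      (((hfd i).norm.ennreal_ofReal.min measurable_const).ennreal_toReal)
  exact measurable_sgn.comp ((Finset.measurable_fun_sum _ fun i _ => hcl i).div_const _)

theorem measurable_agreement (hloss : ∀ i, Measurable (C.loss i)) (hf : Measurable f)
    (hz : Measurable z) : Measurable fun ω => C.agreement (f ω) (z ω) := by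
  refine Finset.measurable_fun_sum _ fun m _ => Measurable.ite ?_ ?_ measurable_const
  · exact measurable_subsetSign hloss hf hz m (measurableSet_singleton 1)
  · exact (measurable_pi_apply m).comp (State.measurable_p.comp hf)

theorem measurableSet_unanimous (hloss : ∀ i, Measurable (C.loss i)) (hf : Measurable f)
    (hz : Measurable z) : MeasurableSet {ω | C.Unanimous (f ω) (z ω)} :=
  (measurable_agreement hloss hf hz (measurableSet_singleton 0)).union
    (measurable_agreement hloss hf hz (measurableSet_singleton 1))

theorem measurable_stepBudget (hloss : ∀ i, Measurable (C.loss i)) (hf : Measurable f)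
    (hz : Measurable z) : Measurable fun ω => C.stepBudget t (f ω) (z ω) := by
  have hu : Measurable fun ω => (f ω).used := State.measurable_used.comp hf
  have ha := measurable_agreement hloss hf hz
  exact ((measurable_const.max (measurable_const.sub hu)).div_const _).min
    ((Real.binEntropy_continuous.measurable.comp ha).const_mul _)

/-- On disagreement, admissibility puts the pair in `achievable`, where the indicator equals
`binaryMIInv`. -/
theorem measurable_noiseLevel (hloss : ∀ i, Measurable (C.loss i)) (hf : Measurable f)
    (hz : Measurable z) (hadm : ∀ ω, C.Admissible t.castSucc (f ω)) :
    Measurable fun ω => C.noiseLevel t (f ω) (z ω) := by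
  classical
  have h : Measurable fun ω => if C.Unanimous (f ω) (z ω) then (0 : ℝ) else
      achievable.indicator (fun x : ℝ × ℝ => binaryMIInv x.1 x.2)
        (C.agreement (f ω) (z ω), C.stepBudget t (f ω) (z ω)) :=
    Measurable.ite (measurableSet_unanimous hloss hf hz) measurable_const
      (measurable_indicator_binaryMIInv.comp ((measurable_agreement hloss hf hz).prodMk
        (measurable_stepBudget (t := t) hloss hf hz)))
  refine (congrArg Measurable (funext fun ω => ?_)).mp h
  rw [noiseLevel]
  by_cases hu : C.Unanimous (f ω) (z ω)
  · rw [if_pos hu, if_pos hu]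
  · rw [if_neg hu, if_neg hu, Set.indicator_of_mem (achievable_of_not_unanimous (hadm ω) hu)]

theorem measurable_rawRelease (hloss : ∀ i, Measurable (C.loss i)) (hf : Measurable f)
    (hz : Measurable z) (hadm : ∀ ω, C.Admissible t.castSucc (f ω)) (hy : Measurable y)
    (j : Fin M) : Measurable fun ω => C.rawRelease t (f ω) (z ω) j (y ω) :=
  (measurable_subsetSign hloss hf hz j).add ((measurable_noiseLevel hloss hf hz hadm).mul hy)

theorem measurable_next_θ (hf : Measurable f) (hz : Measurable z) (hy : Measurable y) :
    Measurable fun ω => (C.next t (f ω) (z ω) (y ω)).θ := by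
  have hθ : Measurable fun ω => (f ω).θ := State.measurable_θ.comp hf
  have h1 : Measurable fun ω => (1 - C.η t * C.decay) • (f ω).θ := by fun_prop
  have h2 : Measurable fun ω => (C.η t * sgn (y ω)) • z ω :=
    ((measurable_sgn.comp hy).const_mul _).smul hz
  exact h1.sub h2

theorem measurable_next_p (hloss : ∀ i, Measurable (C.loss i)) (hf : Measurable f)
    (hz : Measurable z) (hadm : ∀ ω, C.Admissible t.castSucc (f ω)) (hy : Measurable y) :
    Measurable fun ω => (C.next t (f ω) (z ω) (y ω)).p := by
  have hσ := measurable_noiseLevel hloss hf hz hadm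
  have hp : ∀ m, Measurable fun ω => (f ω).p m := fun m =>
    (measurable_pi_apply m).comp (State.measurable_p.comp hf)
  have hg : ∀ m, Measurable fun ω =>
      gaussDensity (C.noiseLevel t (f ω) (z ω)) (y ω - C.subsetSign (f ω).θ (z ω) m) := fun m =>
    hσ.gaussDensity (hy.sub (measurable_subsetSign hloss hf hz m))
  have hmix : Measurable fun ω => ∑ m, (f ω).p m *
      gaussDensity (C.noiseLevel t (f ω) (z ω)) (y ω - C.subsetSign (f ω).θ (z ω) m) :=
    Finset.measurable_fun_sum _ fun m _ => (hp m).mul (hg m)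
  refine measurable_pi_lambda _ fun m => ?_
  simp only [next]
  exact Measurable.ite (measurableSet_unanimous hloss hf hz) (hp m) (((hp m).mul (hg m)).div hmix)

theorem measurable_next_used (hloss : ∀ i, Measurable (C.loss i)) (hf : Measurable f)
    (hz : Measurable z) : Measurable fun ω => (C.next t (f ω) (z ω) (y ω)).used := by
  have h1 : Measurable fun ω => (f ω).used := State.measurable_used.comp hf
  exact h1.add (Measurable.ite (measurableSet_unanimous hloss hf hz) measurable_const
    (measurable_stepBudget hloss hf hz))

theorem measurable_next (hloss : ∀ i, Measurable (C.loss i)) (hf : Measurable f)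
    (hz : Measurable z) (hadm : ∀ ω, C.Admissible t.castSucc (f ω)) (hy : Measurable y) :
    Measurable fun ω => C.next t (f ω) (z ω) (y ω) :=
  measurable_state (measurable_next_θ hf hz hy) (measurable_next_p hloss hf hz hadm hy)
    (measurable_next_used hloss hf hz)

theorem measurable_stateOf (hM : 0 < M) (hB : 0 < C.budget)
    (hloss : ∀ i, Measurable (C.loss i)) (z : Fin T → EuclideanSpace ℝ (Fin d))
    (t : Fin (T + 1)) : Measurable fun y => C.stateOf z y t := by
  induction t using Fin.induction with
  | zero => exact measurable_const
  | succ t ih =>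
    exact measurable_next hloss ih measurable_const
      (fun y => admissible_stateOf hM hB z y _) (measurable_pi_apply t)

theorem admissible_state (hM : 0 < M) (hB : 0 < C.budget) (ω : Sample M T d)
    (t : Fin (T + 1)) : C.Admissible t (C.state ω t) := by
  rw [state_eq_stateOf]
  exact admissible_stateOf hM hB _ _ _

theorem measurable_state_run (hM : 0 < M) (hB : 0 < C.budget)
    (hloss : ∀ i, Measurable (C.loss i)) (j : Fin M) (t : Fin (T + 1)) :
    Measurable fun x : (Fin T → EuclideanSpace ℝ (Fin d)) × (Fin T → ℝ) =>
      C.state (j, x) t := by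
  induction t using Fin.induction with
  | zero => exact measurable_const
  | succ t ih =>
    have hz : Measurable fun x : (Fin T → EuclideanSpace ℝ (Fin d)) × (Fin T → ℝ) => x.1 t :=
      (measurable_pi_apply t).comp measurable_fst
    exact measurable_next hloss ih hz (fun x => admissible_state hM hB _ _)
      (measurable_rawRelease hloss ih hz (fun x => admissible_state hM hB _ _)
        ((measurable_pi_apply t).comp measurable_snd) j)

theorem measurable_internalRelease (hM : 0 < M) (hB : 0 < C.budget)
    (hloss : ∀ i, Measurable (C.loss i)) (j : Fin M) :
    Measurable fun x : (Fin T → EuclideanSpace ℝ (Fin d)) × (Fin T → ℝ) =>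
      C.internalRelease (j, x) :=
  measurable_pi_lambda _ fun t =>
    measurable_rawRelease hloss (measurable_state_run hM hB hloss j _)
      ((measurable_pi_apply t).comp measurable_fst) (fun _ => admissible_state hM hB _ _)
      ((measurable_pi_apply t).comp measurable_snd) j

end Measurability

end Params

/-- Resampling one coordinate of a product probability measure preserves the measure. -/
theorem measurePreserving_update {ι : Type*} [Fintype ι] [DecidableEq ι] {X : ι → Type*}
    [∀ i, MeasurableSpace (X i)] (μ : ∀ i, Measure (X i)) [∀ i, IsProbabilityMeasure (μ i)]
    (t : ι) : MeasurePreserving (fun x : (∀ i, X i) × X t => Function.update x.1 t x.2)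
      ((Measure.pi μ).prod (μ t)) (Measure.pi μ) := by
  have hmeas : Measurable fun x : (∀ i, X i) × X t => Function.update x.1 t x.2 :=
    measurable_update'
  refine ⟨hmeas, (Measure.pi_eq fun s hs => ?_).symm⟩
  rw [Measure.map_apply hmeas (MeasurableSet.univ_pi hs)]
  -- The old coordinate `t` is overwritten, hence unconstrained, and its factor has mass `1`.
  have hset : (fun x : (∀ i, X i) × X t => Function.update x.1 t x.2) ⁻¹' Set.univ.pi s =
      (Set.univ.pi (Function.update s t Set.univ)) ×ˢ s t := by
    ext x
    simp only [Set.mem_preimage, Set.mem_univ_pi, Set.mem_prod]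
    constructor
    · refine fun h => ⟨fun i => ?_, by simpa using h t⟩
      rcases eq_or_ne i t with rfl | hi
      · simp
      · simpa [hi] using h i
    · rintro ⟨h1, h2⟩ i
      rcases eq_or_ne i t with rfl | hi
      · simpa using h2
      · simpa [hi] using h1 i
  rw [hset, Measure.prod_prod, Measure.pi_pi, ← Finset.mul_prod_erase _ _ (Finset.mem_univ t),
    ← Finset.mul_prod_erase _ (fun i => μ i (s i)) (Finset.mem_univ t)]
  simp only [Function.update_self, measure_univ, one_mul]
  rw [mul_comm]
  congr 1
  refine Finset.prod_congr rfl fun i hi => ?_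
  rw [Function.update_of_ne (Finset.ne_of_mem_erase hi)]

theorem integral_pi_eq_integral_update {ι : Type*} [Fintype ι] [DecidableEq ι] {X : ι → Type*}
    [∀ i, MeasurableSpace (X i)] (μ : ∀ i, Measure (X i)) [∀ i, IsProbabilityMeasure (μ i)]
    (t : ι) {f : (∀ i, X i) → ℝ} (hf : Integrable f (Measure.pi μ)) :
    ∫ x, f x ∂Measure.pi μ = ∫ x, ∫ v, f (Function.update x t v) ∂μ t ∂Measure.pi μ := by
  have hp := measurePreserving_update μ t
  have hi := hp.integrable_comp_of_integrable hf
  rw [← hp.map_eq, integral_map hp.measurable.aemeasurable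
    (by rw [hp.map_eq]; exact hf.aestronglyMeasurable), hp.map_eq]
  exact integral_prod _ hi

namespace Params

variable {C : Params N M T d}

/-! ### Backward recursion -/

variable (C) in
/-- Conditional expectation of `G m`, a function of all internal releases, given the releases
before step `t` when `m` is the secret index. -/
def continuation (z : Fin T → EuclideanSpace ℝ (Fin d)) (G : Fin M → (Fin T → ℝ) → ℝ)
    (t : Fin (T + 1)) : Fin M → (Fin T → ℝ) → ℝ :=
  Fin.reverseInduction (motive := fun _ => Fin M → (Fin T → ℝ) → ℝ) G
    (fun t U m y => ∫ x, U m (Function.update y t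
      (C.rawRelease t (C.stateOf z y t.castSucc) (z t) m x)) ∂gaussianReal 0 1) t

variable {z : Fin T → EuclideanSpace ℝ (Fin d)} {G : Fin M → (Fin T → ℝ) → ℝ}

theorem continuation_last : C.continuation z G (Fin.last T) = G :=
  Fin.reverseInduction_last ..

theorem continuation_castSucc (t : Fin T) (m : Fin M) (y : Fin T → ℝ) :
    C.continuation z G t.castSucc m y = ∫ x, C.continuation z G t.succ m (Function.update y t
      (C.rawRelease t (C.stateOf z y t.castSucc) (z t) m x)) ∂gaussianReal 0 1 := by
  rw [continuation, Fin.reverseInduction_castSucc]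
  rfl

/-- Although its argument is a full sequence, the conditional expectation sees only the releases
before step `t`. -/
theorem continuation_congr (t : Fin (T + 1)) (m : Fin M) {y y' : Fin T → ℝ}
    (h : ∀ s : Fin T, s.castSucc < t → y s = y' s) :
    C.continuation z G t m y = C.continuation z G t m y' := by
  induction t using Fin.reverseInduction generalizing y y' with
  | last => rw [show y = y' from funext fun s => h s (Fin.castSucc_lt_last s)]
  | cast t ih =>
    rw [continuation_castSucc, continuation_castSucc, stateOf_congr z _ h]
    refine integral_congr_ae (ae_of_all _ fun x => ih fun s hs => ?_)
    rcases eq_or_ne s t with rfl | hst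
    · simp
    · rw [Function.update_of_ne hst, Function.update_of_ne hst]
      refine h s (Fin.castSucc_lt_castSucc_iff.2 (lt_of_le_of_ne ?_ hst))
      exact Fin.castSucc_lt_succ_iff.1 hs

theorem abs_continuation_le {K : ℝ} (hG : ∀ m y, |G m y| ≤ K) (t : Fin (T + 1)) (m : Fin M)
    (y : Fin T → ℝ) : |C.continuation z G t m y| ≤ K := by
  induction t using Fin.reverseInduction generalizing y with
  | last => rw [continuation_last]; exact hG m y
  | cast t ih =>
    rw [continuation_castSucc]
    have h := norm_integral_le_of_norm_le_const (μ := gaussianReal 0 1) (C := K)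
      (f := fun x => C.continuation z G t.succ m (Function.update y t
        (C.rawRelease t (C.stateOf z y t.castSucc) (z t) m x))) (ae_of_all _ fun x => ih _)
    simpa using h

theorem measurable_continuation (hM : 0 < M) (hB : 0 < C.budget)
    (hloss : ∀ i, Measurable (C.loss i)) (hG : ∀ m, Measurable (G m)) (t : Fin (T + 1))
    (m : Fin M) : Measurable (C.continuation z G t m) := by
  induction t using Fin.reverseInduction with
  | last => rw [continuation_last]; exact hG m
  | cast t ih =>
    have hraw : Measurable fun w : (Fin T → ℝ) × ℝ =>
        C.rawRelease t (C.stateOf z w.1 t.castSucc) (z t) m w.2 :=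
      measurable_rawRelease hloss ((measurable_stateOf hM hB hloss z _).comp measurable_fst)
        measurable_const (fun w => admissible_stateOf hM hB z w.1 _) measurable_snd m
    have hupd : Measurable fun w : (Fin T → ℝ) × ℝ => Function.update w.1 t
        (C.rawRelease t (C.stateOf z w.1 t.castSucc) (z t) m w.2) :=
      (measurable_update' (a := t)).comp (measurable_fst.prodMk hraw)
    have := (ih.comp hupd).stronglyMeasurable.integral_prod_right' (ν := gaussianReal 0 1)
    rw [show C.continuation z G t.castSucc m = _ from
      funext fun y => continuation_castSucc t m y]
    exact this.measurable

/-- The conditional mean of `G` under the posterior is controlled by the remaining budget and the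
relative entropy of the posterior. -/
theorem sum_mul_continuation_le (hM : 0 < M) (hB : 0 < C.budget)
    (hloss : ∀ i, Measurable (C.loss i)) (hGm : ∀ m, Measurable (G m)) {K : ℝ}
    (hGK : ∀ m y, |G m y| ≤ K) {c : ℝ}
    (hG : ∀ p : Fin M → ℝ, (∀ m, 0 < p m) → ∑ m, p m = 1 →
      ∀ y, ∑ m, p m * G m y ≤ c + relEntropyUniform p) (t : Fin (T + 1)) (y : Fin T → ℝ) :
    ∑ m, (C.stateOf z y t).p m * C.continuation z G t m y ≤
      c + (C.budget - (C.stateOf z y t).used) + relEntropyUniform (C.stateOf z y t).p := by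
  induction t using Fin.reverseInduction generalizing y with
  | last =>
    have h := admissible_stateOf hM hB z y (Fin.last T)
    rw [continuation_last]
    have := hG _ h.pos h.sum_eq_one y
    linarith [h.used_le]
  | cast t ih =>
    have h := admissible_stateOf hM hB z y t.castSucc
    have hself : ∀ v, C.stateOf z (Function.update y t v) t.castSucc = C.stateOf z y t.castSucc :=
      fun v => stateOf_congr z _ fun s hs =>
        Function.update_of_ne (Fin.castSucc_lt_castSucc_iff.1 hs).ne _ _
    have ih' : ∀ v, ∑ m, (C.next t (C.stateOf z y t.castSucc) (z t) v).p m *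
          C.continuation z G t.succ m (Function.update y t v) ≤
        c + (C.budget - (C.next t (C.stateOf z y t.castSucc) (z t) v).used) +
          relEntropyUniform (C.next t (C.stateOf z y t.castSucc) (z t) v).p := by
      intro v
      have := ih (Function.update y t v)
      rwa [stateOf_succ, hself, Function.update_self] at this
    simp only [continuation_castSucc]
    generalize C.stateOf z y t.castSucc = st at h ih' ⊢
    -- On unanimity the release is the same constant for all candidates and noises, and posterior
    -- and spending are unchanged.
    by_cases hu : C.Unanimous st (z t)
    · have hnoise : ∀ m x, C.rawRelease t st (z t) m x =
          C.subsetSign st.θ (z t) ⟨0, hM⟩ := by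
        intro m x
        rw [rawRelease, noiseLevel, if_pos hu, zero_mul, add_zero,
          subsetSign_eq_of_unanimous h hu m ⟨0, hM⟩]
      have := ih' (C.subsetSign st.θ (z t) ⟨0, hM⟩)
      rw [next_p_of_unanimous hu, next_used_of_unanimous hu] at this
      simpa [hnoise] using this
    · obtain ⟨h0, h1⟩ := agreement_pos_lt_one h hu
      obtain ⟨hσ, hMI⟩ := noiseLevel_spec h hu
      -- Here `b` contains the budget left after paying for this step; the mutual information added
      -- by the update restores that payment.
      have hstep := sum_mul_integral_le_of_posterior (s := C.subsetSign st.θ (z t))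
        (V := fun m v => C.continuation z G t.succ m (Function.update y t v))
        (b := c + (C.budget - (st.used + C.stepBudget t st (z t)))) hM h.pos h.sum_eq_one
        (C.subsetSign_eq_or st.θ (z t)) hσ h0 h1 (fun m => ?_) (fun v => ?_)
      · rw [agreement_eq_plusMass] at hMI
        rw [hMI] at hstep
        refine hstep.trans (le_of_eq ?_)
        ring
      · have hm : Measurable fun x => C.continuation z G t.succ m (Function.update y t
            (C.subsetSign st.θ (z t) m + C.noiseLevel t st (z t) * x)) :=
          (measurable_continuation hM hB hloss hGm _ m).comp
            ((measurable_update y).comp (by fun_prop))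
        exact Integrable.of_bound hm.aestronglyMeasurable K
          (ae_of_all _ fun x => abs_continuation_le hGK _ _ _)
      · have := ih' v
        rwa [next_p_of_not_unanimous hu, next_used_of_not_unanimous hu] at this

/-- Averaging the conditional expectations over a run with secret index `m` gives a quantity that
does not depend on the step. -/
theorem integral_continuation_eq (hM : 0 < M) (hB : 0 < C.budget)
    (hloss : ∀ i, Measurable (C.loss i)) (hGm : ∀ m, Measurable (G m)) {K : ℝ}
    (hGK : ∀ m y, |G m y| ≤ K) (m : Fin M) (t : Fin (T + 1)) :
    ∫ ν, C.continuation z G t m (C.internalRelease (m, z, ν))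
        ∂Measure.pi (fun _ : Fin T => gaussianReal 0 1) =
      ∫ ν, G m (C.internalRelease (m, z, ν)) ∂Measure.pi (fun _ : Fin T => gaussianReal 0 1) := by
  induction t using Fin.reverseInduction with
  | last => rw [continuation_last]
  | cast t ih =>
    have hmeas : Measurable fun ν => C.internalRelease (m, z, ν) :=
      (measurable_internalRelease hM hB hloss m).comp (measurable_const.prodMk measurable_id)
    -- Tower property: resampling the noise of step `t` keeps the earlier releases and redraws the
    -- one of step `t`; the integrand ignores later ones.
    rw [← ih, integral_pi_eq_integral_update (fun _ : Fin T => gaussianReal 0 1) t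
      (f := fun ν => C.continuation z G t.succ m (C.internalRelease (m, z, ν)))]
    · refine integral_congr_ae (ae_of_all _ fun ν => ?_)
      simp only
      rw [continuation_castSucc]
      refine integral_congr_ae (ae_of_all _ fun x => continuation_congr _ _ fun s hs => ?_)
      rcases eq_or_ne s t with rfl | hst
      · rw [Function.update_self, internalRelease, state_update_noise _ _ _ _ _ _ le_rfl,
          state_eq_stateOf]
        simp
      · have hlt : s < t := lt_of_le_of_ne (Fin.castSucc_lt_succ_iff.1 hs) hst
        rw [Function.update_of_ne hst, internalRelease, internalRelease,
          state_update_noise _ _ _ _ _ _ (Fin.castSucc_le_castSucc_iff.2 hlt.le)]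
        simp [hst]
    · exact Integrable.of_bound ((measurable_continuation hM hB hloss hGm _ m).comp
        hmeas).aestronglyMeasurable K (ae_of_all _ fun ν => abs_continuation_le hGK _ _ _)

/-- The mean of `G` over all secret indices and noises. -/
theorem sum_integral_le (hM : 0 < M) (hB : 0 < C.budget)
    (hloss : ∀ i, Measurable (C.loss i)) (hGm : ∀ m, Measurable (G m)) {K : ℝ}
    (hGK : ∀ m y, |G m y| ≤ K) {c : ℝ}
    (hG : ∀ p : Fin M → ℝ, (∀ m, 0 < p m) → ∑ m, p m = 1 →
      ∀ y, ∑ m, p m * G m y ≤ c + relEntropyUniform p) :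
    ∑ m, 1 / (M : ℝ) * ∫ ν, G m (C.internalRelease (m, z, ν))
      ∂Measure.pi (fun _ : Fin T => gaussianReal 0 1) ≤ c + C.budget := by
  -- The sequence `0` is arbitrary: before the first step no release matters.
  have h := sum_mul_continuation_le (z := z) hM hB hloss hGm hGK hG 0 0
  have hent : relEntropyUniform (C.init.p) = 0 := by
    have hM' : (M : ℝ) ≠ 0 := by exact_mod_cast hM.ne'
    simp [relEntropyUniform, init, hM']
  rw [stateOf_zero, hent] at h
  have heq : ∀ m, ∫ ν, G m (C.internalRelease (m, z, ν))
      ∂Measure.pi (fun _ : Fin T => gaussianReal 0 1) = C.continuation z G 0 m 0 := by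
    intro m
    rw [← integral_continuation_eq hM hB hloss hGm hGK m 0]
    have : ∀ ν, C.continuation z G 0 m (C.internalRelease (m, z, ν)) =
        C.continuation z G 0 m 0 := fun ν =>
      continuation_congr 0 m fun s hs => absurd hs (Fin.not_lt_zero _)
    simp [this]
  simp only [heq]
  simpa [init] using h

end Params

/-! ### Membership inference -/

theorem integral_uniformOn_univ (F : Fin M → ℝ) :
    ∫ m, F m ∂uniformOn (Set.univ : Set (Fin M)) = ∑ m, 1 / (M : ℝ) * F m := by
  rw [integral_fintype Integrable.of_finite]
  refine Finset.sum_congr rfl fun m _ => ?_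
  simp [Measure.real, uniformOn_univ]

/-- Probability that a guess drawn from `Q` is right about the membership of `i` in `S`. -/
def guessSuccess (i : Fin N) (S : Finset (Fin N)) (Q : PMF (Finset (Fin N))) : ℝ :=
  (Q.toOuterMeasure {x' | miaCriterion i S x' = true}).toReal

theorem guessSuccess_eq (i : Fin N) (S : Finset (Fin N)) (Q : PMF (Finset (Fin N))) :
    guessSuccess i S Q = ∑ x', if miaCriterion i S x' = true then (Q x').toReal else 0 := by
  classical
  rw [guessSuccess, PMF.toOuterMeasure_apply_fintype, ENNReal.toReal_sum fun x' _ => ?_]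
  · refine Finset.sum_congr rfl fun x' _ => ?_
    simp only [Set.indicator_apply, Set.mem_ofPred_eq]
    split_ifs <;> simp
  · simp only [Set.indicator_apply]
    split_ifs
    · exact Q.apply_ne_top x'
    · simp

theorem sum_toReal_pmf {α : Type*} [Fintype α] (Q : PMF α) : ∑ x, (Q x).toReal = 1 := by
  rw [← ENNReal.toReal_sum fun x _ => Q.apply_ne_top x, ← tsum_fintype (L := .unconditional α), Q.tsum_coe,
    ENNReal.toReal_one]

theorem guessSuccess_nonneg (i : Fin N) (S : Finset (Fin N)) (Q : PMF (Finset (Fin N))) :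
    0 ≤ guessSuccess i S Q := ENNReal.toReal_nonneg

theorem guessSuccess_le_one (i : Fin N) (S : Finset (Fin N)) (Q : PMF (Finset (Fin N))) :
    guessSuccess i S Q ≤ 1 := by
  rw [guessSuccess_eq, ← sum_toReal_pmf Q]
  refine Finset.sum_le_sum fun x' _ => ?_
  split_ifs
  · exact le_rfl
  · exact ENNReal.toReal_nonneg

theorem guessSuccess_eq_ite (i : Fin N) (S : Finset (Fin N)) (Q : PMF (Finset (Fin N))) :
    guessSuccess i S Q = if i ∈ S then ∑ x', (if i ∈ x' then (Q x').toReal else 0)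
      else 1 - ∑ x', (if i ∈ x' then (Q x').toReal else 0) := by
  rw [guessSuccess_eq, ← sum_toReal_pmf Q, ← Finset.sum_sub_distrib]
  by_cases hS : i ∈ S
  · simp [miaCriterion, hS]
  · rw [if_neg hS]
    refine Finset.sum_congr rfl fun x' _ => ?_
    by_cases hx : i ∈ x' <;> simp [miaCriterion, hS, hx]

/-- If the guess contains `i` with probability `π`, it is right with chance `π` on the subsets
containing `i` and `1 - π` on the equally many others; `π` cancels. -/
theorem sum_guessSuccess {C : Params N M T d} (hbal : C.Balanced) (i : Fin N)
    (Q : PMF (Finset (Fin N))) : ∑ m, guessSuccess i (C.subset m) Q = M / 2 := by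
  have hcard := hbal i
  have hsplit := Finset.card_filter_add_card_filter_not (s := (Finset.univ : Finset (Fin M)))
    (fun m => i ∈ C.subset m)
  rw [Finset.card_univ, Fintype.card_fin] at hsplit
  have h1 : 2 * ((Finset.univ.filter fun m => i ∈ C.subset m).card : ℝ) = M := by
    exact_mod_cast hcard
  have h2 : ((Finset.univ.filter fun m => i ∈ C.subset m).card : ℝ) +
      (Finset.univ.filter fun m => i ∉ C.subset m).card = M := by
    exact_mod_cast hsplit
  simp only [guessSuccess_eq_ite]
  rw [Finset.sum_ite, Finset.sum_const, Finset.sum_const, nsmul_eq_mul, nsmul_eq_mul]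
  rw [show ((Finset.univ.filter fun m => i ∈ C.subset m).card : ℝ) = M / 2 by linarith,
    show ((Finset.univ.filter fun m => i ∉ C.subset m).card : ℝ) = M / 2 by linarith]
  ring

theorem measurable_guessSuccess {Ω : Type*} [MeasurableSpace Ω] (i : Fin N)
    (S : Finset (Fin N)) {A : Ω → PMF (Finset (Fin N))} (hA : ∀ X', Measurable fun y => A y X') :
    Measurable fun y => guessSuccess i S (A y) := by
  simp only [guessSuccess_eq]
  refine Finset.measurable_fun_sum _ fun x' _ => ?_
  split_ifs
  · exact (hA x').ennreal_toReal
  · exact measurable_const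

theorem blindSuccess_eq_half {C : Params N M T d} (hM : 0 < M) (hbal : C.Balanced) (i : Fin N)
    (Q : PMF (Finset (Fin N))) :
    blindSuccess (uniformOn (Set.univ : Set (Fin M))) C.subset (miaCriterion i) Q = 1 / 2 := by
  have hM' : (M : ℝ) ≠ 0 := by exact_mod_cast hM.ne'
  have h : blindSuccess (uniformOn (Set.univ : Set (Fin M))) C.subset (miaCriterion i) Q =
      ∫ m, guessSuccess i (C.subset m) Q ∂uniformOn (Set.univ : Set (Fin M)) := rfl
  rw [h, integral_uniformOn_univ, ← Finset.mul_sum, sum_guessSuccess hbal]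
  field_simp

theorem isPriorSuccess_half {C : Params N M T d} (hM : 0 < M) (hbal : C.Balanced) (i : Fin N) :
    IsPriorSuccess (uniformOn (Set.univ : Set (Fin M))) C.subset (miaCriterion i) (1 / 2) := by
  refine ⟨⟨PMF.pure ∅, blindSuccess_eq_half hM hbal i _⟩, ?_⟩
  rintro _ ⟨Q, rfl⟩
  exact (blindSuccess_eq_half hM hbal i Q).le

theorem log_mean_exp_guessSuccess_le {C : Params N M T d} (hM : 0 < M) (hbal : C.Balanced)
    (i : Fin N) (Q : PMF (Finset (Fin N))) (t : ℝ) :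
    Real.log ((∑ m, Real.exp (t * guessSuccess i (C.subset m) Q)) / M) ≤
      Real.log ((1 + Real.exp t) / 2) := by
  have hM' : (0 : ℝ) < M := by exact_mod_cast hM
  refine Real.log_le_log (div_pos (Finset.sum_pos (fun m _ => Real.exp_pos _)
    ⟨⟨0, hM⟩, Finset.mem_univ _⟩) hM') ?_
  rw [div_le_iff₀ hM']
  refine (Finset.sum_le_sum fun m _ => exp_mul_le_affine (guessSuccess_nonneg i (C.subset m) Q)
    (guessSuccess_le_one i (C.subset m) Q) t).trans (le_of_eq ?_)
  rw [Finset.sum_add_distrib, ← Finset.sum_mul, sum_guessSuccess hbal]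
  simp
  ring

/-! ### Attacks on the released bits. -/

section Attack

variable {C : Params N M T d}
  {A : (Fin T → EuclideanSpace ℝ (Fin d)) × (Fin T → ℝ) → PMF (Finset (Fin N))}

theorem measurable_observation (hM : 0 < M) (hB : 0 < C.budget)
    (hloss : ∀ i, Measurable (C.loss i)) (m : Fin M) :
    Measurable fun x : (Fin T → EuclideanSpace ℝ (Fin d)) × (Fin T → ℝ) =>
      C.observation (m, x) := by
  have h := Params.measurable_internalRelease hM hB hloss m
  exact measurable_fst.prodMk (measurable_pi_lambda _ fun t =>
    measurable_sgn.comp ((measurable_pi_apply t).comp h))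

theorem measurable_guessSuccess_observation (hM : 0 < M) (hB : 0 < C.budget)
    (hloss : ∀ i, Measurable (C.loss i)) (i : Fin N) (hA : ∀ X', Measurable fun y => A y X')
    (m : Fin M) : Measurable fun x : (Fin T → EuclideanSpace ℝ (Fin d)) × (Fin T → ℝ) =>
      guessSuccess i (C.subset m) (A (C.observation (m, x))) :=
  (measurable_guessSuccess i (C.subset m) hA).comp (measurable_observation hM hB hloss m)

theorem norm_guessSuccess_le (i : Fin N) (S : Finset (Fin N)) (Q : PMF (Finset (Fin N))) :
    ‖guessSuccess i S Q‖ ≤ 1 := by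
  rw [Real.norm_eq_abs, abs_of_nonneg (guessSuccess_nonneg _ _ _)]
  exact guessSuccess_le_one _ _ _

theorem integrable_guessSuccess (hM : 0 < M) (hB : 0 < C.budget)
    (hloss : ∀ i, Measurable (C.loss i)) (i : Fin N) (hA : ∀ X', Measurable fun y => A y X')
    (m : Fin M) : Integrable (fun x : (Fin T → EuclideanSpace ℝ (Fin d)) × (Fin T → ℝ) =>
      guessSuccess i (C.subset m) (A (C.observation (m, x))))
      ((Measure.pi fun _ => stdGaussian (EuclideanSpace ℝ (Fin d))).prod
        (Measure.pi fun _ => gaussianReal 0 1)) :=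
  Integrable.of_bound (measurable_guessSuccess_observation hM hB hloss i hA m).aestronglyMeasurable
    1 (ae_of_all _ fun _ => norm_guessSuccess_le _ _ _)

/-- Fubini with the directions outermost, so that the bound can be proved for each fixed `z`. -/
theorem attackSuccess_eq (hM : 0 < M) (hB : 0 < C.budget)
    (hloss : ∀ i, Measurable (C.loss i)) (i : Fin N) (hA : ∀ X', Measurable fun y => A y X') :
    attackSuccess (sampleMeasure M T d) C.secret C.observation (miaCriterion i) A =
      ∫ z, ∑ m, 1 / (M : ℝ) * (∫ ν, guessSuccess i (C.subset m) (A (C.observation (m, z, ν)))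
        ∂Measure.pi (fun _ : Fin T => gaussianReal 0 1))
        ∂Measure.pi (fun _ : Fin T => stdGaussian (EuclideanSpace ℝ (Fin d))) := by
  have : NeZero M := ⟨hM.ne'⟩
  have hint := integrable_guessSuccess hM hB hloss i hA
  have hjoint : Measurable fun ω : Sample M T d =>
      guessSuccess i (C.subset ω.1) (A (C.observation ω)) :=
    measurable_from_prod_countable_right
      (measurable_guessSuccess_observation hM hB hloss i hA)
  have hintω : Integrable (fun ω : Sample M T d =>
      guessSuccess i (C.subset ω.1) (A (C.observation ω))) (sampleMeasure M T d) := by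
    unfold sampleMeasure
    exact Integrable.of_bound hjoint.aestronglyMeasurable 1
      (ae_of_all _ fun _ => norm_guessSuccess_le _ _ _)
  have h : attackSuccess (sampleMeasure M T d) C.secret C.observation (miaCriterion i) A =
      ∫ ω, guessSuccess i (C.subset ω.1) (A (C.observation ω)) ∂sampleMeasure M T d := rfl
  rw [h]
  unfold sampleMeasure at hintω ⊢
  rw [integral_prod _ hintω, integral_uniformOn_univ,
    integral_finsetSum _ fun m _ => (hint m).integral_prod_left.const_mul _]
  refine Finset.sum_congr rfl fun m _ => ?_
  rw [integral_const_mul, integral_prod _ (hint m)]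

theorem attackSuccess_variational_le (hM : 0 < M) (hbal : C.Balanced) (hB : 0 < C.budget)
    (hloss : ∀ i, Measurable (C.loss i)) (i : Fin N) (hA : ∀ X', Measurable fun y => A y X')
    (t : ℝ) :
    t * attackSuccess (sampleMeasure M T d) C.secret C.observation (miaCriterion i) A -
      Real.log ((1 + Real.exp t) / 2) ≤ C.budget := by
  have hz : ∀ z : Fin T → EuclideanSpace ℝ (Fin d),
      t * ∑ m, 1 / (M : ℝ) * (∫ ν, guessSuccess i (C.subset m) (A (C.observation (m, z, ν)))
        ∂Measure.pi (fun _ : Fin T => gaussianReal 0 1)) ≤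
      Real.log ((1 + Real.exp t) / 2) + C.budget := by
    intro z
    have hsgn : Measurable fun y : Fin T → ℝ => (z, fun s => sgn (y s)) :=
      measurable_const.prodMk (measurable_pi_lambda _ fun s =>
        measurable_sgn.comp (measurable_pi_apply s))
    -- `G` reads only the signs of the releases, while the posterior in the bound conditions on
    -- their real values.
    have h := Params.sum_integral_le (C := C) (z := z)
      (G := fun m y => t * guessSuccess i (C.subset m) (A (z, fun s => sgn (y s))))
      hM hB hloss
      (fun m => ((measurable_guessSuccess i (C.subset m) hA).comp hsgn).const_mul t)
      (K := |t|) (fun m y => ?_) (c := Real.log ((1 + Real.exp t) / 2)) (fun p hp hp1 y => ?_)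
    · simp only [integral_const_mul] at h
      rw [Finset.mul_sum]
      refine le_trans (le_of_eq (Finset.sum_congr rfl fun m _ => ?_)) h
      rw [mul_left_comm]
      rfl
    · rw [abs_mul, abs_of_nonneg (guessSuccess_nonneg _ _ _)]
      exact mul_le_of_le_one_right (abs_nonneg t) (guessSuccess_le_one _ _ _)
    · refine (sum_mul_le_relEntropyUniform_add_log hM hp hp1 _).trans ?_
      have := log_mean_exp_guessSuccess_le hM hbal i (A (z, fun s => sgn (y s))) t
      linarith
  rw [attackSuccess_eq hM hB hloss i hA, ← integral_const_mul, sub_le_iff_le_add']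
  refine (integral_mono ((integrable_finsetSum _ fun m _ =>
    (integrable_guessSuccess hM hB hloss i hA m).integral_prod_left.const_mul _).const_mul t)
      (integrable_const _) hz).trans (le_of_eq ?_)
  simp

theorem attackSuccess_mem_Icc (hM : 0 < M) (i : Fin N) :
    0 ≤ attackSuccess (sampleMeasure M T d) C.secret C.observation (miaCriterion i) A ∧
    attackSuccess (sampleMeasure M T d) C.secret C.observation (miaCriterion i) A ≤ 1 := by
  have : NeZero M := ⟨hM.ne'⟩
  have : IsProbabilityMeasure (sampleMeasure M T d) := by
    unfold sampleMeasure
    infer_instance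
  refine ⟨integral_nonneg fun ω => ENNReal.toReal_nonneg, ?_⟩
  have h := norm_integral_le_of_norm_le_const (μ := sampleMeasure M T d) (C := 1)
    (f := fun ω => guessSuccess i (C.secret ω) (A (C.observation ω))) 
    (ae_of_all _ fun _ => norm_guessSuccess_le _ _ _)
  rw [probReal_univ, one_mul] at h
  exact (le_abs_self _).trans h

end Attack

end PACZero

end

theorem corollary1 {N M T d : ℕ} (C : PACZero.Params N M T d)
    (hM : 0 < M) (hbal : C.Balanced) (hμ : 0 < C.μ) (hbudget : 0 < C.budget)
    (hloss : ∀ i, Measurable (C.loss i)) (i : Fin N) :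
    PACZero.IsPriorSuccess (uniformOn (Set.univ : Set (Fin M))) C.subset
        (PACZero.miaCriterion i) (1 / 2) ∧
      ∀ A : (Fin T → EuclideanSpace ℝ (Fin d)) × (Fin T → ℝ) → PMF (Finset (Fin N)),
        (∀ X', Measurable fun y => A y X') →
          PACZero.binaryKL
            (PACZero.attackSuccess (PACZero.sampleMeasure M T d) C.secret C.observation
              (PACZero.miaCriterion i) A) (1 / 2) ≤ C.budget := by
  refine ⟨PACZero.isPriorSuccess_half hM hbal i, fun A hA => ?_⟩
  obtain ⟨h0, h1⟩ := PACZero.attackSuccess_mem_Icc (C := C) (A := A) hM i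
  exact PACZero.binaryKL_half_le h0 h1
    (PACZero.attackSuccess_variational_le hM hbal hbudget hloss i hA)
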